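/- Let $\alpha>0$ and let $\boldsymbol f:\mathbb R^2\to\mathbb R^2$ be of class $C^{1,\alpha}$, i.e. $\boldsymbol f$ is $C^1$ and its first partial derivatives are locally $\alpha$-Hölder continuous. Let $\boldsymbol p$ be an equilibrium of $d\boldsymbol x/dt=\boldsymbol f(\boldsymbol x)$, i.e. $\boldsymbol f(\boldsymbol p)=\boldsymbol 0$, and let $\lambda_1,\lambda_2\in\mathbb C$ be the eigenvalues, counted with multiplicity, of the Jacobian matrix of $\boldsymbol f$ at $\boldsymbol p$ (the case $\lambda_1=\lambda_2$ is allowed). Then: (i) if $\lambda_1,\lambda_2$ are real with the same sign (both nonzero), then $\boldsymbol p$ is a node; (ii) if $\lambda_1,\lambda_2$ are real with opposite signs, then $\boldsymbol p$ is a saddle; (iii) if $\lambda_1,\lambda_2$ are non-real with nonzero real part, then $\boldsymbol p$ is a focus. Here an incoming (outgoing) trajectory of $\boldsymbol p$ is a solution $\boldsymbol x$ on $[0,\infty)$ (on $(-\infty,0]$), not passing through $\boldsymbol p$, with $\boldsymbol x(t)\to\boldsymbol p$ as $t\to+\infty$ (as $t\to-\infty$). The equilibrium $\boldsymbol p$ is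 attracting (repelling) if for every $\varepsilon>0$ there is $\delta>0$ such that every solution with $|\boldsymbol x(0)-\boldsymbol p|<\delta$ exists for all $t\ge0$ (all $t\le0$), stays within distance less than $\varepsilon$ of $\boldsymbol p$ for these $t$, and tends to $\boldsymbol p$ as $t\to+\infty$ (as $t\to-\infty$). An attracting (repelling) equilibrium is a node if along every incoming (outgoing) trajectory the direction $\boldsymbol d(t)=\boldsymbol f(\boldsymbol x(t))/|\boldsymbol f(\boldsymbol x(t))|$ converges to a constant vector as $\boldsymbol x(t)\to\boldsymbol p$; it is a focus if along every such trajectory $\boldsymbol d(t)=(\cos\theta(t),\sin\theta(t))$ with a continuous angle $\theta$ that tends to $+\infty$ or to $-\infty$ as $\boldsymbol x(t)\to\boldsymbol p$. The equilibrium $\boldsymbol p$ is a saddle if, up to translation of time (and comparing trajectories only near $\boldsymbol p$), it has exactly two incoming and exactly two outgoing trajectories, and these alternate around $\boldsymbol p$: some homeomorphism from a neighbourhood of $\boldsymbol p$ onto a neighbourhood of $\boldsymbol 0$, sending $\boldsymbol p$ to $\boldsymbol 0$, maps the parts near $\boldsymbol p$ of the two incoming trajectories into the positive and the negative first half-axis,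 and those of the two outgoing trajectories into the positive and the negative second half-axis. -/

import Mathlib

open Filter Topology Set

/-- The Euclidean plane. -/
abbrev Plane : Type := EuclideanSpace ℝ (Fin 2)

/-- The Jacobian matrix of a planar vector field at `x`; its `(i, j)` entry is the partial
derivative of the `i`-th component in the direction of the `j`-th coordinate. -/
noncomputable def jacobian (f : Plane → Plane) (x : Plane) : Matrix (Fin 2) (Fin 2) ℝ :=
  Matrix.of fun i j => (fderiv ℝ f x (EuclideanSpace.single j 1)) i

/-- `f` is of class `C^{1,α}`: it is `C¹` and all its first partial derivatives are locally
`α`-Hölder continuous. -/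
def IsClassC1Holder (α : NNReal) (f : Plane → Plane) : Prop :=
  ContDiff ℝ 1 f ∧
    ∀ i j : Fin 2, ∀ x : Plane, ∃ U ∈ 𝓝 x, ∃ C : NNReal,
      HolderOnWith C α (fun y => jacobian f y i j) U

/-- `x` solves `dx/dt = f(x)` on the set `s` of times (one-sided derivatives at end points). -/
def IsTrajectoryOn (f : Plane → Plane) (x : ℝ → Plane) (s : Set ℝ) : Prop :=
  IsIntegralCurveOn x (fun _ => f) s

/-- An incoming trajectory of `p`: a solution on `[0, ∞)`, other than the constant solution `p`,
that tends to `p` as `t → ∞`. -/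
def IsIncoming (f : Plane → Plane) (p : Plane) (x : ℝ → Plane) : Prop :=
  IsTrajectoryOn f x (Ici 0) ∧ (∀ t ∈ Ici (0 : ℝ), x t ≠ p) ∧ Tendsto x atTop (𝓝 p)

/-- An outgoing trajectory of `p`: a solution on `(-∞, 0]`, other than the constant solution `p`,
that tends to `p` as `t → -∞`. -/
def IsOutgoing (f : Plane → Plane) (p : Plane) (x : ℝ → Plane) : Prop :=
  IsTrajectoryOn f x (Iic 0) ∧ (∀ t ∈ Iic (0 : ℝ), x t ≠ p) ∧ Tendsto x atBot (𝓝 p)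

/-- Attracting equilibrium: solutions starting near `p` exist for all `t ≥ 0`, stay near `p`
and tend to `p` as `t → ∞`. -/
def IsAttracting (f : Plane → Plane) (p : Plane) : Prop :=
  f p = 0 ∧
    ∀ ε > (0 : ℝ), ∃ δ > (0 : ℝ), ∀ x₀ ∈ Metric.ball p δ,
      (∃ x : ℝ → Plane, x 0 = x₀ ∧ IsTrajectoryOn f x (Ici 0)) ∧
      ∀ x : ℝ → Plane, x 0 = x₀ → IsTrajectoryOn f x (Ici 0) →
        (∀ t ∈ Ici (0 : ℝ), x t ∈ Metric.ball p ε) ∧ Tendsto x atTop (𝓝 p)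

/-- Repelling equilibrium: the time reversal of an attracting one. -/
def IsRepelling (f : Plane → Plane) (p : Plane) : Prop :=
  f p = 0 ∧
    ∀ ε > (0 : ℝ), ∃ δ > (0 : ℝ), ∀ x₀ ∈ Metric.ball p δ,
      (∃ x : ℝ → Plane, x 0 = x₀ ∧ IsTrajectoryOn f x (Iic 0)) ∧
      ∀ x : ℝ → Plane, x 0 = x₀ → IsTrajectoryOn f x (Iic 0) →
        (∀ t ∈ Iic (0 : ℝ), x t ∈ Metric.ball p ε) ∧ Tendsto x atBot (𝓝 p)

/-- The direction `f(x(t)) / |f(x(t))|` of a trajectory. -/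
noncomputable def direction (f : Plane → Plane) (x : ℝ → Plane) (t : ℝ) : Plane :=
  ‖f (x t)‖⁻¹ • f (x t)

/-- The direction of `x` is eventually nonzero and converges along `l` to a constant
(unit) vector. -/
def DirectionConverges (f : Plane → Plane) (x : ℝ → Plane) (l : Filter ℝ) : Prop :=
  ∃ v : Plane, ‖v‖ = 1 ∧ Tendsto (direction f x) l (𝓝 v)

/-- The direction of `x` rotates infinitely many times along `l`: on the time set `s` it has a
continuous angle, and this angle tends to `+∞` or to `-∞`. -/
def DirectionRotates (f : Plane → Plane) (x : ℝ → Plane) (s : Set ℝ) (l : Filter ℝ) : Prop :=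
  ∃ θ : ℝ → ℝ, ContinuousOn θ s ∧
    (∀ t ∈ s, direction f x t = !₂[Real.cos (θ t), Real.sin (θ t)]) ∧
    (Tendsto θ l atTop ∨ Tendsto θ l atBot)

/-- A node: attracting or repelling, and the direction of every trajectory tending to `p`
converges. -/
def IsNode (f : Plane → Plane) (p : Plane) : Prop :=
  (IsAttracting f p ∧ ∀ x, IsIncoming f p x → DirectionConverges f x atTop) ∨
  (IsRepelling f p ∧ ∀ x, IsOutgoing f p x → DirectionConverges f x atBot)

/-- A focus: attracting or repelling, and the direction of every trajectory tending to `p`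
rotates infinitely many times. -/
def IsFocus (f : Plane → Plane) (p : Plane) : Prop :=
  (IsAttracting f p ∧ ∀ x, IsIncoming f p x → DirectionRotates f x (Ici 0) atTop) ∨
  (IsRepelling f p ∧ ∀ x, IsOutgoing f p x → DirectionRotates f x (Iic 0) atBot)

/-- A saddle: up to time translation there are exactly two incoming trajectories `a₀, a₁` and
exactly two outgoing trajectories `b₀, b₁`, and they alternate around `p`: some homeomorphism
between neighbourhoods of `p` and of the origin takes (the parts near `p` of) `a₀, b₀, a₁, b₁` to
the positive first, positive second, negative first and negative second half-axis. -/
def IsSaddle (f : Plane → Plane) (p : Plane) : Prop :=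
  f p = 0 ∧
    ∃ a₀ a₁ b₀ b₁ : ℝ → Plane,
      IsIncoming f p a₀ ∧ IsIncoming f p a₁ ∧ IsOutgoing f p b₀ ∧ IsOutgoing f p b₁ ∧
      (∀ x, IsIncoming f p x →
        ∃ c : ℝ, (∀ᶠ t in atTop, x t = a₀ (t + c)) ∨ (∀ᶠ t in atTop, x t = a₁ (t + c))) ∧
      (∀ x, IsOutgoing f p x →
        ∃ c : ℝ, (∀ᶠ t in atBot, x t = b₀ (t + c)) ∨ (∀ᶠ t in atBot, x t = b₁ (t + c))) ∧
      ∃ h : OpenPartialHomeomorph Plane Plane, p ∈ h.source ∧ h p = 0 ∧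
        (∀ᶠ t in atTop, 0 < h (a₀ t) 0 ∧ h (a₀ t) 1 = 0) ∧
        (∀ᶠ t in atBot, h (b₀ t) 0 = 0 ∧ 0 < h (b₀ t) 1) ∧
        (∀ᶠ t in atTop, h (a₁ t) 0 < 0 ∧ h (a₁ t) 1 = 0) ∧
        (∀ᶠ t in atBot, h (b₁ t) 0 = 0 ∧ h (b₁ t) 1 < 0)

/-! Trace and determinant of the Jacobian `A` at `p` decide the type: a negative determinant gives a
saddle, a positive one with discriminant `≥ 0` a node, a negative discriminant with nonzero trace a
focus. Outgoing trajectories and repelling equilibria are handled by replacing `f` with `-f` and `t`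
with `-t`.

Node and focus. When the determinant is positive and the trace negative, the form `D |v|² + |adj(A)
v|²` is a strict Lyapunov function, so solutions near `p` decay exponentially
(`exists_exponential_decay`). Along a trajectory `y = f(x(t))` solves the linear equation `y' =
Df(x(t)) y`, so its angle obeys a scalar equation without the modulus of `y`
(`IsIncoming.exists_direction_angle`). As `x → p` the angular speed approaches `a + r cos(2θ - φ)`,
where `r² - a²` is a quarter of the discriminant. If `r < |a|` the speed is eventually bounded away
from `0` and the direction rotates forever. If `|a| ≤ r` the limit equation has rest points; the
Hölder condition and the exponential decay make the error exponentially small, which forces the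
angle to converge even when `|a| = r` (`exists_tendsto_angle`). Only this case needs more than `C¹`.

Saddle. In eigencoordinates the field is, near `0`, a small Lipschitz perturbation of `(-l u, m v)`,
extended to the whole plane. The form `w₂² - w₁²/4` of the difference `w` of two solutions grows
exponentially wherever it is positive, so bounded solutions differ by vectors in a cone. Shooting
finds a bounded solution over each `u`; hence the bounded solutions fill the graph of a
`1/2`-Lipschitz function (`IsSaddlePerturbation.exists_stable_graph`), whose two halves are the two
incoming orbits. The outgoing orbits form a similar graph over the other axis, and
`exists_homeomorph_straightening` sends both graphs to the axes. -/

/-! ### Global solutions of Lipschitz equations. -/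

theorem exists_integralCurve_of_local {E : Type*} [NormedAddCommGroup E] [NormedSpace ℝ E]
    {F : E → E} {K : NNReal} (hF : LipschitzWith K F) (x₀ : E)
    (h : ∀ T > (0 : ℝ), ∃ x : ℝ → E, x 0 = x₀ ∧ ∀ t ∈ Ioo (-T) T, HasDerivAt x (F (x t)) t) :
    ∃ x : ℝ → E, x 0 = x₀ ∧ ∀ t, HasDerivAt x (F (x t)) t := by
  choose! X hX0 hX using h
  have agree : ∀ S T : ℝ, 0 < S → S ≤ T → EqOn (X S) (X T) (Ioo (-S) S) := by
    intro S T hS hST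
    refine ODE_solution_unique_of_mem_Ioo (v := fun _ => F) (s := fun _ => univ) (K := K) (t₀ := 0)
      (fun _ _ => hF.lipschitzOnWith) ⟨by linarith, hS⟩
      (fun t ht => ⟨hX S hS t ht, trivial⟩)
      (fun t ht => ⟨hX T (hS.trans_le hST) t ⟨by linarith [ht.1], by linarith [ht.2]⟩, trivial⟩) ?_
    rw [hX0 S hS, hX0 T (hS.trans_le hST)]
  have key : ∀ T > 0, EqOn (fun t => X (|t| + 1) t) (X T) (Ioo (-T) T) := by
    intro T hT t ht
    have ht' : |t| < T := abs_lt.2 ht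
    have h0 := abs_nonneg t
    rcases le_total (|t| + 1) T with h | h
    · exact agree _ _ (by linarith) h (abs_lt.1 (by linarith))
    · exact (agree _ _ hT h ht).symm
  refine ⟨fun t => X (|t| + 1) t, by simpa using hX0 1 one_pos, fun t => ?_⟩
  have hT : 0 < |t| + 1 := by positivity
  have ht : t ∈ Ioo (-(|t| + 1)) (|t| + 1) := abs_lt.1 (by linarith)
  exact (hX _ hT t ht).congr_of_eventuallyEq ((key _ hT).eventuallyEq_of_mem (Ioo_mem_nhds ht.1 ht.2))

theorem exists_integralCurve_of_bounded {E : Type*} [NormedAddCommGroup E] [NormedSpace ℝ E]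
    [CompleteSpace E] {F : E → E} {K : NNReal} (hF : LipschitzWith K F) {M : NNReal}
    (hM : ∀ x, ‖F x‖ ≤ M) (x₀ : E) :
    ∃ x : ℝ → E, x 0 = x₀ ∧ ∀ t, HasDerivAt x (F (x t)) t := by
  refine exists_integralCurve_of_local hF x₀ fun T hT => ?_
  have hT0 : (0 : ℝ) ∈ Icc (-T) T := ⟨by linarith, hT.le⟩
  -- At speed at most `M` the solution cannot leave the ball of radius `M * T` by time `T`, so every
  -- `T` is admissible.
  have hPL : IsPicardLindelof (fun _ : ℝ => F) (tmin := -T) (tmax := T) ⟨0, hT0⟩ x₀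
      (M * ⟨T, hT.le⟩) 0 M K := by
    refine IsPicardLindelof.of_time_independent (fun x _ => hM x) hF.lipschitzOnWith ?_
    simp only [sub_zero, zero_sub, neg_neg, max_self, NNReal.coe_zero]
    exact le_rfl
  obtain ⟨x, hx0, hx⟩ := hPL.exists_eq_forall_mem_Icc_hasDerivWithinAt₀
  exact ⟨x, hx0, fun t ht => (hx t (Ioo_subset_Icc_self ht)).hasDerivAt (Icc_mem_nhds ht.1 ht.2)⟩

theorem norm_sub_le_gronwallBound_of_hasDerivAt {E : Type*} [NormedAddCommGroup E]
    [NormedSpace ℝ E] {x x' : ℝ → E} {K ε T : ℝ} (hK : 0 ≤ K) (hε : 0 ≤ ε)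
    (hx : ∀ t, HasDerivAt x (x' t) t) (hb : ∀ t, ‖x' t‖ ≤ K * ‖x t - x 0‖ + ε)
    {t : ℝ} (ht : t ∈ Icc 0 T) : ‖x t - x 0‖ ≤ gronwallBound 0 K ε T := by
  have h1 := norm_le_gronwallBound_of_norm_deriv_right_le (f := fun t => x t - x 0) (f' := x')
    (a := 0) (b := T) (δ := 0) (K := K) (ε := ε)
    (fun t _ => ((hx t).continuousAt.sub continuousAt_const).continuousWithinAt)
    (fun t _ => ((hx t).sub_const _).hasDerivWithinAt) (by simp) (fun t _ => hb t) t ht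
  exact h1.trans (gronwallBound_mono le_rfl hε hK (by linarith [ht.2]))

/-- On a fixed interval `(-T, T)` Grönwall confines the solution to radius `R`, where `|F| ≤ M`.
Clipping the components of `F` at `±M` gives a bounded field obeying the same a priori bound, so the
clipping is never active there. -/
theorem exists_integralCurve_of_lipschitz {F : ℝ × ℝ → ℝ × ℝ} {K : NNReal}
    (hF : LipschitzWith K F) (x₀ : ℝ × ℝ) :
    ∃ x : ℝ → ℝ × ℝ, x 0 = x₀ ∧ ∀ t, HasDerivAt x (F (x t)) t := by
  refine exists_integralCurve_of_local hF x₀ fun T hT => ?_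
  set R := gronwallBound 0 K ‖F x₀‖ T with hR
  have hR0 : 0 ≤ R := by
    have := gronwallBound_mono (δ := 0) (K := K) (ε := ‖F x₀‖) le_rfl (norm_nonneg _) K.coe_nonneg hT.le
    rwa [gronwallBound_x0] at this
  set M : ℝ := K * R + ‖F x₀‖ with hMdef
  have hM0 : 0 ≤ M := by positivity
  have hMM : -M ≤ M := by linarith
  let c : ℝ → ℝ := fun a => projIcc (-M) M hMM a
  have hc1 : LipschitzWith 1 c := by
    have := (LipschitzWith.projIcc hMM)
    exact this
  have hc2 : ∀ a, |c a| ≤ M := fun a => abs_le.2 (projIcc (-M) M hMM a).2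
  have hc3 : ∀ a, |a| ≤ M → c a = a := fun a ha => by
    simp only [c]; rw [projIcc_of_mem hMM (abs_le.1 ha)]
  have hc4 : ∀ a, |c a| ≤ |a| := fun a => by
    have := hc1.dist_le_mul a 0
    rwa [hc3 0 (by simpa using hM0), NNReal.coe_one, one_mul, Real.dist_eq, Real.dist_eq, sub_zero,
      sub_zero] at this
  let G : ℝ × ℝ → ℝ × ℝ := fun q => (c (F q).1, c (F q).2)
  have hG : LipschitzWith K G := by
    have h1 : LipschitzWith K fun q => c (F q).1 := by
      simpa using! hc1.comp (LipschitzWith.prod_fst.comp hF)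
    have h2 : LipschitzWith K fun q => c (F q).2 := by
      simpa using! hc1.comp (LipschitzWith.prod_snd.comp hF)
    simpa using h1.prodMk h2
  obtain ⟨x, hx0, hx⟩ := exists_integralCurve_of_bounded hG (M := ⟨M, hM0⟩)
    (fun q => by simpa [G, Prod.norm_def] using! ⟨hc2 _, hc2 _⟩) x₀
  have hGF : ∀ q, ‖G q‖ ≤ ‖F q‖ := fun q => by
    simp only [G, Prod.norm_def, Real.norm_eq_abs]
    exact max_le_max (hc4 _) (hc4 _)
  have hFK : ∀ q, ‖F q‖ ≤ K * ‖q - x₀‖ + ‖F x₀‖ := fun q => by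
    have := hF.norm_sub_le q x₀
    linarith [norm_le_norm_sub_add (F q) (F x₀)]
  have hbd : ∀ t ∈ Ioo (-T) T, ‖x t - x₀‖ ≤ R := by
    intro t ht
    rcases le_total 0 t with h0 | h0
    · have := norm_sub_le_gronwallBound_of_hasDerivAt (T := T) K.coe_nonneg (norm_nonneg (F x₀)) hx
        (fun t => by rw [hx0]; exact (hGF _).trans (hFK _)) (t := t) ⟨h0, ht.2.le⟩
      rwa [hx0] at this
    · have := norm_sub_le_gronwallBound_of_hasDerivAt (T := T) (x := fun t => x (-t))
        (x' := fun t => -G (x (-t))) K.coe_nonneg (norm_nonneg (F x₀))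
        (fun t => by simpa using! (hx (-t)).scomp t (hasDerivAt_neg t))
        (fun t => by
          rw [neg_zero, hx0, norm_neg]; exact (hGF _).trans (hFK _))
        (t := -t) ⟨by linarith, by linarith [ht.1]⟩
      simpa [hx0] using this
  refine ⟨x, hx0, fun t ht => ?_⟩
  have hle : ‖F (x t)‖ ≤ M := (hFK _).trans (by
    have := mul_le_mul_of_nonneg_left (hbd t ht) K.coe_nonneg
    simp only [hMdef]; linarith)
  have : G (x t) = F (x t) := Prod.ext
    (hc3 _ ((norm_fst_le (F (x t))).trans hle)) (hc3 _ ((norm_snd_le (F (x t))).trans hle))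
  exact this ▸ hx t

/-! ### Scalar differential inequalities, time shifts and forward uniqueness. -/

theorem le_mul_exp_of_hasDerivWithinAt_le {q q' : ℝ → ℝ} {c : ℝ}
    (hq : ∀ t ∈ Ici (0 : ℝ), HasDerivWithinAt q (q' t) (Ici 0) t)
    (hle : ∀ t ∈ Ici (0 : ℝ), q' t ≤ c * q t) {s t : ℝ} (hs : 0 ≤ s) (hst : s ≤ t) :
    q t ≤ q s * Real.exp (c * (t - s)) := by
  have hd : ∀ t ∈ Ici (0 : ℝ), HasDerivWithinAt (fun t => q t * Real.exp (-c * t))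
      (q' t * Real.exp (-c * t) + q t * (Real.exp (-c * t) * (-c))) (Ici 0) t := by
    intro t ht
    have h2 : HasDerivAt (fun t : ℝ => Real.exp (-c * t)) (Real.exp (-c * t) * (-c)) t := by
      simpa using ((hasDerivAt_id t).const_mul (-c)).exp
    exact (hq t ht).mul h2.hasDerivWithinAt
  have hanti : AntitoneOn (fun t => q t * Real.exp (-c * t)) (Ici 0) := by
    refine antitoneOn_of_hasDerivWithinAt_nonpos (convex_Ici 0)
      (fun t ht => (hd t ht).continuousWithinAt)
      (fun t ht => (hd t (interior_subset ht)).mono interior_subset) ?_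
    intro t ht
    have h1 := hle t (interior_subset ht)
    have h2 := Real.exp_pos (-c * t)
    nlinarith
  have := hanti (mem_Ici.2 hs) (mem_Ici.2 (hs.trans hst)) hst
  simp only at this
  have e : Real.exp (c * (t - s)) = Real.exp (-c * s) * Real.exp (c * t) := by
    rw [← Real.exp_add]; ring_nf
  have e2 : Real.exp (-c * t) * Real.exp (c * t) = 1 := by
    rw [← Real.exp_add]; simp
  rw [e]
  calc q t = q t * Real.exp (-c * t) * Real.exp (c * t) := by rw [mul_assoc, e2, mul_one]
    _ ≤ q s * Real.exp (-c * s) * Real.exp (c * t) :=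
        mul_le_mul_of_nonneg_right this (Real.exp_pos _).le
    _ = _ := by ring

theorem mul_exp_le_of_le_hasDerivWithinAt {q q' : ℝ → ℝ} {c : ℝ}
    (hq : ∀ t ∈ Ici (0 : ℝ), HasDerivWithinAt q (q' t) (Ici 0) t)
    (hle : ∀ t ∈ Ici (0 : ℝ), c * q t ≤ q' t) {s t : ℝ} (hs : 0 ≤ s) (hst : s ≤ t) :
    q s * Real.exp (c * (t - s)) ≤ q t := by
  have := le_mul_exp_of_hasDerivWithinAt_le (q := fun t => -q t) (q' := fun t => -q' t) (c := c)
    (fun t ht => (hq t ht).neg) (fun t ht => by linarith [hle t ht]) hs hst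
  linarith

/-- Translating a solution on `[0, ∞)` forward in time. -/
theorem IsIntegralCurveOn.shift_Ici {E : Type*} [NormedAddCommGroup E] [NormedSpace ℝ E]
    {F : E → E} {x : ℝ → E} (hx : IsIntegralCurveOn x (fun _ => F) (Ici 0)) {T : ℝ} (hT : 0 ≤ T) :
    IsIntegralCurveOn (fun t => x (t + T)) (fun _ => F) (Ici 0) := by
  intro t ht
  have h1 := hx (t + T) (add_nonneg (mem_Ici.1 ht) hT)
  have h2 : HasDerivWithinAt (fun t : ℝ => t + T) 1 (Ici 0) t :=
    (hasDerivWithinAt_id t _).add_const T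
  simpa using! HasDerivWithinAt.scomp t h1 h2 fun s hs => add_nonneg (mem_Ici.1 hs) hT

/-- Forward uniqueness for a locally Lipschitz field. -/
theorem IsIntegralCurveOn.eqOn_of_locallyLipschitz {E : Type*} [NormedAddCommGroup E]
    [NormedSpace ℝ E] {F : E → E} (hF : LocallyLipschitz F) {x y : ℝ → E}
    (hx : IsIntegralCurveOn x (fun _ => F) (Ici 0)) (hy : IsIntegralCurveOn y (fun _ => F) (Ici 0))
    (h0 : x 0 = y 0) : EqOn x y (Ici 0) := by
  intro T hT
  have hxc : ContinuousOn x (Icc 0 T) := hx.continuousOn.mono Icc_subset_Ici_self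
  have hyc : ContinuousOn y (Icc 0 T) := hy.continuousOn.mono Icc_subset_Ici_self
  obtain ⟨K, hK⟩ := hF.locallyLipschitzOn.exists_lipschitzOnWith_of_compact
    (s := x '' Icc 0 T ∪ y '' Icc 0 T)
    ((isCompact_Icc.image_of_continuousOn hxc).union (isCompact_Icc.image_of_continuousOn hyc))
  refine ODE_solution_unique_of_mem_Icc_right (v := fun _ => F) (K := K)
    (s := fun _ => x '' Icc 0 T ∪ y '' Icc 0 T) (fun _ _ => hK) hxc
    (fun t ht => (hx t ht.1).mono (Ici_subset_Ici.2 ht.1))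
    (fun t ht => Or.inl (mem_image_of_mem _ (Ico_subset_Icc_self ht))) hyc
    (fun t ht => (hy t ht.1).mono (Ici_subset_Ici.2 ht.1))
    (fun t ht => Or.inr (mem_image_of_mem _ (Ico_subset_Icc_self ht))) h0 ⟨hT, le_rfl⟩

/-! ### The stable curve of a global perturbation of a linear saddle. -/

/-- `F` differs from the linear field `(-l u, m v)` by a field with a small Lipschitz constant. -/
structure IsSaddlePerturbation (l m ε : ℝ) (F : ℝ × ℝ → ℝ × ℝ) : Prop where
  eps_nonneg : 0 ≤ ε
  left_pos : 0 < l
  right_pos : 0 < m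
  le_left : 8 * ε ≤ l
  le_right : 8 * ε ≤ m
  zero : F 0 = 0
  fst : ∀ p q, |(F p).1 - (F q).1 + l * (p.1 - q.1)| ≤ ε * ‖p - q‖
  snd : ∀ p q, |(F p).2 - (F q).2 - m * (p.2 - q.2)| ≤ ε * ‖p - q‖

theorem HasDerivWithinAt.prod_fst {x : ℝ → ℝ × ℝ} {v : ℝ × ℝ} {s : Set ℝ} {t : ℝ}
    (h : HasDerivWithinAt x v s t) : HasDerivWithinAt (fun t => (x t).1) v.1 s t :=
  (ContinuousLinearMap.fst ℝ ℝ ℝ).hasFDerivAt.comp_hasDerivWithinAt t h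

theorem HasDerivWithinAt.prod_snd {x : ℝ → ℝ × ℝ} {v : ℝ × ℝ} {s : Set ℝ} {t : ℝ}
    (h : HasDerivWithinAt x v s t) : HasDerivWithinAt (fun t => (x t).2) v.2 s t :=
  (ContinuousLinearMap.snd ℝ ℝ ℝ).hasFDerivAt.comp_hasDerivWithinAt t h

/-- The norm of `ℝ × ℝ` is the maximum norm, hence at most the Euclidean one; this turns the
perturbation into an error `ε (w₁² + w₂²)` in the derivatives of quadratic forms. -/
theorem abs_mul_le_of_le_mul_norm {a b e ε : ℝ} {w : ℝ × ℝ} (hε : 0 ≤ ε) (ha : |a| ≤ ‖w‖)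
    (he : |e| ≤ ε * ‖w‖) (hb : b = ε * (w.1 ^ 2 + w.2 ^ 2)) : |a * e| ≤ b := by
  have h1 : ‖w‖ ^ 2 ≤ w.1 ^ 2 + w.2 ^ 2 := by
    rw [Prod.norm_def]
    rcases max_choice ‖w.1‖ ‖w.2‖ with h | h <;> rw [h, Real.norm_eq_abs, sq_abs] <;>
      nlinarith [sq_nonneg w.1, sq_nonneg w.2]
  rw [abs_mul, hb]
  calc |a| * |e| ≤ ‖w‖ * (ε * ‖w‖) := mul_le_mul ha he (abs_nonneg _) (norm_nonneg _)
    _ = ε * ‖w‖ ^ 2 := by ring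
    _ ≤ _ := mul_le_mul_of_nonneg_left h1 hε

namespace IsSaddlePerturbation

variable {l m ε : ℝ} {F : ℝ × ℝ → ℝ × ℝ}

theorem lipschitzWith (hF : IsSaddlePerturbation l m ε F) :
    ∃ K : NNReal, LipschitzWith K F := by
  have h1 := hF.left_pos
  have h2 := hF.right_pos
  have h3 := hF.eps_nonneg
  refine ⟨NNReal.mk (l + m + ε) (by positivity), LipschitzWith.of_dist_le_mul fun p q => ?_⟩
  rw [dist_eq_norm, dist_eq_norm, NNReal.coe_mk]
  have hn := norm_nonneg (p - q)
  have n1 : |p.1 - q.1| ≤ ‖p - q‖ := norm_fst_le (p - q)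
  have n2 : |p.2 - q.2| ≤ ‖p - q‖ := norm_snd_le (p - q)
  have a1 := mul_le_mul_of_nonneg_left n1 h1.le
  have a2 := mul_le_mul_of_nonneg_left n2 h2.le
  have b1 : |l * (p.1 - q.1)| ≤ l * ‖p - q‖ := by rwa [abs_mul, abs_of_pos h1]
  have b2 : |m * (p.2 - q.2)| ≤ m * ‖p - q‖ := by rwa [abs_mul, abs_of_pos h2]
  have c1 := abs_le.1 (hF.fst p q)
  have c2 := abs_le.1 (hF.snd p q)
  rw [abs_le] at b1 b2
  have d1 : 0 ≤ l * ‖p - q‖ := by positivity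
  have d2 : 0 ≤ m * ‖p - q‖ := by positivity
  refine max_le (abs_le.2 ?_) (abs_le.2 ?_) <;> simp only [Prod.fst_sub, Prod.snd_sub] <;>
    constructor <;> nlinarith

/-- The indefinite form `w₂² - w₁² / 4` of the difference of two solutions grows exponentially. -/
theorem quadForm_growth (hF : IsSaddlePerturbation l m ε F) {x y : ℝ → ℝ × ℝ}
    (hx : IsIntegralCurveOn x (fun _ => F) (Ici 0)) (hy : IsIntegralCurveOn y (fun _ => F) (Ici 0))
    {s t : ℝ} (hs : 0 ≤ s) (hst : s ≤ t) :
    (((x s).2 - (y s).2) ^ 2 - ((x s).1 - (y s).1) ^ 2 / 4) * Real.exp (m * (t - s)) ≤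
      ((x t).2 - (y t).2) ^ 2 - ((x t).1 - (y t).1) ^ 2 / 4 := by
  refine mul_exp_le_of_le_hasDerivWithinAt
    (q := fun t => ((x t).2 - (y t).2) ^ 2 - ((x t).1 - (y t).1) ^ 2 / 4)
    (q' := fun t => 2 * ((x t).2 - (y t).2) * ((F (x t)).2 - (F (y t)).2) -
      2 * ((x t).1 - (y t).1) * ((F (x t)).1 - (F (y t)).1) / 4) ?_ ?_ hs hst
  · intro t ht
    have h1 := ((hx t ht).prod_fst.sub (hy t ht).prod_fst).pow 2
    have h2 := ((hx t ht).prod_snd.sub (hy t ht).prod_snd).pow 2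
    convert! h2.sub (h1.div_const 4) using 1
    simp
  · intro t _
    have h1 := hF.fst (x t) (y t)
    have h2 := hF.snd (x t) (y t)
    have e1 := abs_le.1 (abs_mul_le_of_le_mul_norm hF.eps_nonneg (norm_fst_le (x t - y t)) h1 rfl)
    have e2 := abs_le.1 (abs_mul_le_of_le_mul_norm hF.eps_nonneg (norm_snd_le (x t - y t)) h2 rfl)
    simp only [Prod.fst_sub, Prod.snd_sub] at e1 e2
    generalize (x t).1 - (y t).1 = a at *
    generalize (x t).2 - (y t).2 = b at *
    generalize (F (x t)).1 - (F (y t)).1 = c at *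
    generalize (F (x t)).2 - (F (y t)).2 = d at *
    have := hF.le_left
    have := hF.le_right
    have := hF.left_pos
    have := hF.right_pos
    have := hF.eps_nonneg
    nlinarith [mul_nonneg (sub_nonneg.2 hF.le_left) (sq_nonneg a),
      mul_nonneg (sub_nonneg.2 hF.le_right) (sq_nonneg b), mul_nonneg hF.eps_nonneg (sq_nonneg a),
      mul_nonneg hF.right_pos.le (sq_nonneg a), mul_nonneg hF.left_pos.le (sq_nonneg a),
      mul_nonneg hF.eps_nonneg (sq_nonneg b), mul_nonneg hF.right_pos.le (sq_nonneg b)]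

/-- A positive value of the indefinite form at time `s` would grow like `exp (m (t - s))`, which two
bounded solutions cannot afford. -/
theorem abs_snd_sub_le (hF : IsSaddlePerturbation l m ε F) {x y : ℝ → ℝ × ℝ}
    (hx : IsIntegralCurveOn x (fun _ => F) (Ici 0)) (hy : IsIntegralCurveOn y (fun _ => F) (Ici 0))
    {C : ℝ} (hxC : ∀ t ∈ Ici (0 : ℝ), ‖x t‖ ≤ C) (hyC : ∀ t ∈ Ici (0 : ℝ), ‖y t‖ ≤ C)
    {s : ℝ} (hs : 0 ≤ s) : |(x s).2 - (y s).2| ≤ |(x s).1 - (y s).1| / 2 := by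
  have hC : 0 ≤ C := (norm_nonneg _).trans (hxC 0 self_mem_Ici)
  suffices h : ((x s).2 - (y s).2) ^ 2 - ((x s).1 - (y s).1) ^ 2 / 4 ≤ 0 by
    refine abs_le_of_sq_le_sq ?_ (by positivity)
    rw [div_pow, sq_abs]; linarith
  by_contra! h
  set Q := ((x s).2 - (y s).2) ^ 2 - ((x s).1 - (y s).1) ^ 2 / 4 with hQ
  have ht : Tendsto (fun t => Q * Real.exp (m * (t - s))) atTop atTop := by
    refine Tendsto.const_mul_atTop h (Real.tendsto_exp_atTop.comp ?_)
    exact Tendsto.const_mul_atTop hF.right_pos (tendsto_atTop_add_const_right _ _ tendsto_id)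
  obtain ⟨t, ht1, ht2⟩ := ((ht.eventually_gt_atTop ((2 * C) ^ 2)).and (eventually_ge_atTop s)).exists
  have h1 := hF.quadForm_growth hx hy hs ht2
  rw [← hQ] at h1
  have h3 : |(x t).2 - (y t).2| ≤ 2 * C := by
    have := norm_snd_le (x t - y t)
    have h4 := norm_sub_le (x t) (y t)
    simp only [Prod.snd_sub, Real.norm_eq_abs] at this
    linarith [hxC t (hs.trans ht2), hyC t (hs.trans ht2)]
  have h5 := sq_le_sq' (by linarith [abs_nonneg ((x t).2 - (y t).2)]) h3
  rw [sq_abs] at h5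
  nlinarith [sq_nonneg ((x t).1 - (y t).1)]

theorem isIntegralCurveOn_zero (hF : IsSaddlePerturbation l m ε F) :
    IsIntegralCurveOn (fun _ => (0 : ℝ × ℝ)) (fun _ => F) (Ici 0) := by
  intro t _
  simpa [hF.zero] using hasDerivWithinAt_const t (Ici (0 : ℝ)) (0 : ℝ × ℝ)

/-- A solution inside the cone `|v| ≤ |u| / 2` decays exponentially. -/
theorem sq_fst_le_of_cone (hF : IsSaddlePerturbation l m ε F) {x : ℝ → ℝ × ℝ}
    (hx : IsIntegralCurveOn x (fun _ => F) (Ici 0))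
    (hc : ∀ t ∈ Ici (0 : ℝ), (x t).2 ^ 2 ≤ (x t).1 ^ 2 / 4) {t : ℝ} (ht : 0 ≤ t) :
    (x t).1 ^ 2 ≤ (x 0).1 ^ 2 * Real.exp (-l * t) := by
  have := le_mul_exp_of_hasDerivWithinAt_le (q := fun t => (x t).1 ^ 2)
    (q' := fun t => 2 * (x t).1 * (F (x t)).1) (c := -l) ?_ ?_ le_rfl ht
  · simpa using this
  · intro t ht
    convert! (hx t ht).prod_fst.pow 2 using 1
    simp
  · intro t ht
    have h1 := hF.fst (x t) 0
    rw [hF.zero] at h1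
    have e1 := abs_le.1 (abs_mul_le_of_le_mul_norm hF.eps_nonneg (norm_fst_le (x t - 0)) h1 rfl)
    simp only [sub_zero, Prod.fst_zero] at e1
    nlinarith [hc t ht, hF.le_left, hF.eps_nonneg, hF.left_pos,
      mul_nonneg (sub_nonneg.2 hF.le_left) (sq_nonneg (x t).1),
      mul_nonneg hF.eps_nonneg (sub_nonneg.2 (hc t ht)),
      mul_nonneg hF.eps_nonneg (sq_nonneg (x t).1)]

theorem norm_le_of_cone {q : ℝ × ℝ} (h : q.2 ^ 2 ≤ q.1 ^ 2 / 4) : ‖q‖ ≤ |q.1| :=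
  max_le le_rfl (sq_le_sq.1 (by nlinarith [sq_nonneg q.1]))

theorem tendsto_zero_of_cone (hF : IsSaddlePerturbation l m ε F) {x : ℝ → ℝ × ℝ}
    (hx : IsIntegralCurveOn x (fun _ => F) (Ici 0))
    (hc : ∀ t ∈ Ici (0 : ℝ), (x t).2 ^ 2 ≤ (x t).1 ^ 2 / 4) : Tendsto x atTop (𝓝 0) := by
  have h1 : Tendsto (fun t => (x 0).1 ^ 2 * Real.exp (-l * t)) atTop (𝓝 0) := by
    suffices h : Tendsto (fun t => Real.exp (-l * t)) atTop (𝓝 0) by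
      simpa using h.const_mul ((x 0).1 ^ 2)
    refine Real.tendsto_exp_atBot.comp ?_
    exact tendsto_id.const_mul_atTop_of_neg (neg_lt_zero.2 hF.left_pos)
  have h2 : Tendsto (fun t => ‖x t‖ ^ 2) atTop (𝓝 0) := by
    refine squeeze_zero' (Eventually.of_forall fun t => by positivity) ?_ h1
    filter_upwards [eventually_ge_atTop 0] with t ht
    have h3 := norm_le_of_cone (hc t ht)
    have h4 := hF.sq_fst_le_of_cone hx hc ht
    have h5 := pow_le_pow_left₀ (norm_nonneg _) h3 2
    rw [sq_abs] at h5
    exact h5.trans h4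
  rw [tendsto_zero_iff_norm_tendsto_zero]
  simpa using h2.sqrt

theorem abs_fst_le_of_cone (hF : IsSaddlePerturbation l m ε F) {x : ℝ → ℝ × ℝ}
    (hx : IsIntegralCurveOn x (fun _ => F) (Ici 0))
    (hc : ∀ t ∈ Ici (0 : ℝ), (x t).2 ^ 2 ≤ (x t).1 ^ 2 / 4) {t : ℝ} (ht : 0 ≤ t) :
    |(x t).1| ≤ |(x 0).1| := by
  refine sq_le_sq.1 ((hF.sq_fst_le_of_cone hx hc ht).trans (mul_le_of_le_one_right (sq_nonneg _) ?_))
  rw [Real.exp_le_one_iff]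
  nlinarith [hF.left_pos]

/-- Once a solution is in the cone `|v| > |u| / 2`, it stays there. -/
theorem mem_cone_of_le (hF : IsSaddlePerturbation l m ε F) {x : ℝ → ℝ × ℝ}
    (hx : IsIntegralCurveOn x (fun _ => F) (Ici 0)) {s t : ℝ} (hs : 0 ≤ s) (hst : s ≤ t)
    (h : (x s).1 ^ 2 / 4 < (x s).2 ^ 2) : (x t).1 ^ 2 / 4 < (x t).2 ^ 2 := by
  have := hF.quadForm_growth hx hF.isIntegralCurveOn_zero hs hst
  simp only [Prod.snd_zero, Prod.fst_zero, sub_zero] at this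
  have h2 := mul_pos (sub_pos.2 h) (Real.exp_pos (m * (t - s)))
  linarith

/-- A solution cannot visit both halves of the cone `|v| > |u| / 2`. -/
theorem not_both_cones (hF : IsSaddlePerturbation l m ε F) {x : ℝ → ℝ × ℝ}
    (hx : IsIntegralCurveOn x (fun _ => F) (Ici 0)) {s t : ℝ} (hs : 0 ≤ s) (ht : 0 ≤ t)
    (h1 : |(x s).1| / 2 < (x s).2) (h2 : |(x t).1| / 2 < -(x t).2) : False := by
  have hcont : ContinuousOn (fun t => (x t).2) (Ici 0) := continuous_snd.comp_continuousOn hx.continuousOn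
  have q1 : (x s).1 ^ 2 / 4 < (x s).2 ^ 2 := by
    have := abs_nonneg (x s).1
    rw [← sq_abs (x s).1]; nlinarith
  have q2 : (x t).1 ^ 2 / 4 < (x t).2 ^ 2 := by
    have := abs_nonneg (x t).1
    rw [← sq_abs (x t).1]; nlinarith
  have p1 : 0 < (x s).2 := lt_of_le_of_lt (by positivity) h1
  have p2 : (x t).2 < 0 := by
    have := abs_nonneg (x t).1
    linarith
  have hsub : uIcc s t ⊆ Ici 0 := fun r hr => (le_min hs ht).trans hr.1
  -- Between the visits the second coordinate vanishes, but the cone entered first is never left and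
  -- contains no such point.
  obtain ⟨r, hr, hr0⟩ : (0 : ℝ) ∈ (fun t => (x t).2) '' uIcc s t :=
    intermediate_value_uIcc (hcont.mono hsub) (mem_uIcc.2 (Or.inr ⟨p2.le, p1.le⟩))
  have hq : (x r).1 ^ 2 / 4 < (x r).2 ^ 2 := by
    rcases le_total s t with h | h
    · rw [uIcc_of_le h] at hr; exact hF.mem_cone_of_le hx hs hr.1 q1
    · rw [uIcc_of_ge h] at hr; exact hF.mem_cone_of_le hx ht hr.1 q2
  simp only at hr0
  rw [hr0] at hq
  nlinarith [sq_nonneg (x r).1]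

/-- Shooting: over every `u` there is a point whose solution stays in the cone `|v| ≤ |u| / 2`. -/
theorem exists_solution_cone (hF : IsSaddlePerturbation l m ε F) (u : ℝ) :
    ∃ x : ℝ → ℝ × ℝ, (x 0).1 = u ∧ (∀ t, HasDerivAt x (F (x t)) t) ∧
      ∀ t ∈ Ici (0 : ℝ), (x t).2 ^ 2 ≤ (x t).1 ^ 2 / 4 := by
  obtain ⟨K, hK⟩ := hF.lipschitzWith
  choose φ hφ0 hφ using fun v : ℝ => exists_integralCurve_of_lipschitz hK (u, v)
  have hon : ∀ v, IsIntegralCurveOn (φ v) (fun _ => F) (Ici 0) :=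
    fun v t _ => (hφ v t).hasDerivWithinAt
  have hcont : ∀ t ∈ Ici (0 : ℝ), Continuous fun v => φ v t := by
    intro t ht
    refine (LipschitzWith.of_dist_le_mul (K := NNReal.mk (Real.exp (K * t)) (Real.exp_pos _).le)
      fun v w => ?_).continuous
    have := dist_le_of_trajectories_ODE (v := fun _ => F) (K := K) (a := 0) (b := t)
      (f := φ v) (g := φ w) (δ := dist v w) (fun _ => hK)
      ((hon v).continuousOn.mono Icc_subset_Ici_self) (fun s _ => (hφ v s).hasDerivWithinAt)
      ((hon w).continuousOn.mono Icc_subset_Ici_self) (fun s _ => (hφ w s).hasDerivWithinAt)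
      (by rw [hφ0, hφ0, Prod.dist_eq]; simp) t ⟨ht, le_rfl⟩
    rw [sub_zero] at this
    rw [NNReal.coe_mk]
    linarith
  -- `U` and `V` collect the starting heights whose solutions enter the upper and the lower cone.
  -- They are open by continuous dependence, nonempty and disjoint, so by connectedness they cannot
  -- cover the line.
  let U : Set ℝ := ⋃ t ∈ Ici (0 : ℝ), {v | |(φ v t).1| / 2 < (φ v t).2}
  let V : Set ℝ := ⋃ t ∈ Ici (0 : ℝ), {v | |(φ v t).1| / 2 < -(φ v t).2}
  have hU : IsOpen U := isOpen_biUnion fun t ht => by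
    have := hcont t ht
    exact isOpen_lt (by fun_prop) (by fun_prop)
  have hV : IsOpen V := isOpen_biUnion fun t ht => by
    have := hcont t ht
    exact isOpen_lt (by fun_prop) (by fun_prop)
  by_contra! hno
  have hcover : univ ⊆ U ∪ V := by
    intro v _
    obtain ⟨t, ht, hlt⟩ := hno (φ v) (by rw [hφ0]) (hφ v)
    have h2 : |(φ v t).1| / 2 < |(φ v t).2| := by
      have := sq_lt_sq.1 (show ((φ v t).1 / 2) ^ 2 < (φ v t).2 ^ 2 by rw [div_pow]; linarith)
      rwa [abs_div, abs_two] at this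
    rcases lt_abs.1 h2 with h | h
    · exact Or.inl (mem_biUnion ht h)
    · exact Or.inr (mem_biUnion ht h)
  have hUne : (univ ∩ U).Nonempty := by
    refine ⟨|u| + 1, trivial, mem_biUnion (x := 0) self_mem_Ici ?_⟩
    simp only [mem_ofPred_eq, hφ0]
    linarith [abs_nonneg u]
  have hVne : (univ ∩ V).Nonempty := by
    refine ⟨-(|u| + 1), trivial, mem_biUnion (x := 0) self_mem_Ici ?_⟩
    simp only [mem_ofPred_eq, hφ0]
    linarith [abs_nonneg u]
  obtain ⟨v, -, h1, h2⟩ := isPreconnected_univ U V hU hV hcover hUne hVne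
  simp only [U, V, mem_iUnion, mem_ofPred_eq] at h1 h2
  obtain ⟨s, hs, h1⟩ := h1
  obtain ⟨t, ht, h2⟩ := h2
  exact hF.not_both_cones (hon v) hs ht h1 h2

/-- The stable curve of a perturbed linear saddle is the graph of a `1/2`-Lipschitz function. -/
theorem exists_stable_graph (hF : IsSaddlePerturbation l m ε F) :
    ∃ s : ℝ → ℝ, s 0 = 0 ∧ (∀ a b, |s a - s b| ≤ |a - b| / 2) ∧
      (∀ x : ℝ → ℝ × ℝ, IsIntegralCurveOn x (fun _ => F) (Ici 0) →
        (∃ C, ∀ t ∈ Ici (0 : ℝ), ‖x t‖ ≤ C) → ∀ t ∈ Ici (0 : ℝ), (x t).2 = s (x t).1) ∧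
      ∀ u ≠ 0, ∃ x : ℝ → ℝ × ℝ, (x 0).1 = u ∧ IsIntegralCurveOn x (fun _ => F) (Ici 0) ∧
        (∀ t ∈ Ici (0 : ℝ), ‖x t‖ ≤ |u|) ∧ (∀ t ∈ Ici (0 : ℝ), 0 < (x t).1 * u) ∧
        Tendsto x atTop (𝓝 0) := by
  choose X hX0 hX hXc using hF.exists_solution_cone
  have hXon : ∀ u, IsIntegralCurveOn (X u) (fun _ => F) (Ici 0) :=
    fun u t _ => (hX u t).hasDerivWithinAt
  have hXb : ∀ u, ∀ t ∈ Ici (0 : ℝ), ‖X u t‖ ≤ |u| := fun u t ht => by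
    have := hF.abs_fst_le_of_cone (hXon u) (hXc u) ht
    rw [hX0] at this
    exact (norm_le_of_cone (hXc u t ht)).trans this
  have hgraph : ∀ x : ℝ → ℝ × ℝ, IsIntegralCurveOn x (fun _ => F) (Ici 0) →
      (∃ C, ∀ t ∈ Ici (0 : ℝ), ‖x t‖ ≤ C) →
      ∀ t ∈ Ici (0 : ℝ), (x t).2 = (X (x t).1 0).2 := by
    rintro x hx ⟨C, hC⟩ t ht
    -- The shifted solution and the shooting solution over the same abscissa are both bounded; their
    -- first coordinates agree at time `0`, so the cone estimate makes the second ones agree.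
    have h := hF.abs_snd_sub_le (hx.shift_Ici ht) (hXon (x t).1) (C := max C |(x t).1|)
      (fun r hr => (hC _ (mem_Ici.2 (add_nonneg hr ht))).trans (le_max_left _ _))
      (fun r hr => (hXb _ r hr).trans (le_max_right _ _)) le_rfl
    simp only [zero_add, hX0, sub_self, abs_zero, zero_div] at h
    exact sub_eq_zero.1 (abs_eq_zero.1 (le_antisymm h (abs_nonneg _)))
  have hzero : (X 0 0).2 = 0 := by
    have := hgraph _ hF.isIntegralCurveOn_zero ⟨0, by simp⟩ 0 self_mem_Ici
    simpa using this.symm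
  refine ⟨fun u => (X u 0).2, hzero, ?_, hgraph, ?_⟩
  · intro a b
    have := hF.abs_snd_sub_le (hXon a) (hXon b) (C := max |a| |b|)
      (fun r hr => (hXb _ r hr).trans (le_max_left _ _))
      (fun r hr => (hXb _ r hr).trans (le_max_right _ _)) le_rfl
    simpa only [hX0] using this
  · intro u hu
    refine ⟨X u, hX0 u, hXon u, hXb u, ?_, hF.tendsto_zero_of_cone (hXon u) (hXc u)⟩
    -- Inside the cone a vanishing first coordinate forces the point `0`, and uniqueness then makes
    -- the whole solution zero, against `u ≠ 0`.
    have hne : ∀ t ∈ Ici (0 : ℝ), (X u t).1 ≠ 0 := by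
      intro t ht h0
      have h1 : X u t = 0 := by
        refine norm_le_zero_iff.1 ((norm_le_of_cone (hXc u t ht)).trans ?_)
        rw [h0, abs_zero]
      obtain ⟨K, hK⟩ := hF.lipschitzWith
      have h2 : X u = fun _ => 0 := ODE_solution_unique_univ (v := fun _ => F) (K := K)
        (s := fun _ => univ) (t₀ := t) (fun _ => hK.lipschitzOnWith) (fun r => ⟨hX u r, trivial⟩)
        (fun r => ⟨by simpa [hF.zero] using hasDerivAt_const r (0 : ℝ × ℝ), trivial⟩) h1
      have h3 := hX0 u
      rw [h2] at h3
      exact hu h3.symm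
    intro t ht
    by_contra! hle
    have hc : ContinuousOn (fun r => (X u r).1 * u) (Icc 0 t) :=
      ((continuous_fst.comp_continuousOn (hXon u).continuousOn).mul_const u).mono
        Icc_subset_Ici_self
    obtain ⟨r, hr, hr0⟩ := intermediate_value_Icc' (mem_Ici.1 ht) hc
      (show (0 : ℝ) ∈ _ from ⟨hle, by simp only [hX0]; exact mul_self_nonneg u⟩)
    exact hne r hr.1 ((mul_eq_zero.1 hr0).resolve_right hu)

end IsSaddlePerturbation

namespace IsSaddlePerturbation

variable {l m ε : ℝ} {F : ℝ × ℝ → ℝ × ℝ}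

/-- Two solutions on the stable curve, on the same side of the equilibrium, have the same orbit. -/
theorem exists_shift_eq (hF : IsSaddlePerturbation l m ε F) {s : ℝ → ℝ} {a x : ℝ → ℝ × ℝ}
    (ha : IsIntegralCurveOn a (fun _ => F) (Ici 0)) (hx : IsIntegralCurveOn x (fun _ => F) (Ici 0))
    (has : ∀ t ∈ Ici (0 : ℝ), (a t).2 = s (a t).1) (hxs : (x 0).2 = s (x 0).1)
    (ha0 : Tendsto a atTop (𝓝 0)) (hpos : 0 < (x 0).1 * (a 0).1)
    (hle : |(x 0).1| ≤ |(a 0).1|) : ∃ c, ∀ t ∈ Ici (0 : ℝ), x t = a (t + c) := by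
  -- Multiplying by `(a 0).1` treats both sides of the equilibrium at once. The product decreases
  -- from a value above the target to below it, so `a` passes over the abscissa of `x 0`; the graph
  -- makes the points equal.
  have hac : ContinuousOn (fun t => (a t).1 * (a 0).1) (Ici 0) :=
    (continuous_fst.comp_continuousOn ha.continuousOn).mul_const _
  have hlim : Tendsto (fun t => (a t).1 * (a 0).1) atTop (𝓝 0) := by
    simpa using ((continuous_fst.tendsto _).comp ha0).mul_const (a 0).1
  obtain ⟨T, hT1, hT0⟩ := ((hlim.eventually (gt_mem_nhds hpos)).and (eventually_ge_atTop 0)).exists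
  have hmem : (x 0).1 * (a 0).1 ∈ Icc ((a T).1 * (a 0).1) ((a 0).1 * (a 0).1) := by
    refine ⟨hT1.le, ?_⟩
    calc (x 0).1 * (a 0).1 ≤ |(x 0).1 * (a 0).1| := le_abs_self _
      _ ≤ |(a 0).1| * |(a 0).1| := by
        rw [abs_mul]; exact mul_le_mul_of_nonneg_right hle (abs_nonneg _)
      _ = _ := abs_mul_abs_self _
  obtain ⟨c, hc, hceq⟩ := intermediate_value_Icc' hT0 (hac.mono Icc_subset_Ici_self) hmem
  have hne : (a 0).1 ≠ 0 := by rintro h; simp [h] at hpos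
  have h1 : (a c).1 = (x 0).1 := mul_right_cancel₀ hne hceq
  obtain ⟨K, hK⟩ := hF.lipschitzWith
  refine ⟨c, hx.eqOn_of_locallyLipschitz hK.locallyLipschitz (ha.shift_Ici hc.1) ?_⟩
  simp only [zero_add]
  exact Prod.ext h1.symm (by rw [hxs, has c hc.1, h1])

end IsSaddlePerturbation

/-! ### From the global model to a local saddle in eigencoordinates. -/

/-- A field with hyperbolic saddle linear part agrees near `0` with a global perturbation. -/
theorem exists_isSaddlePerturbation_eqOn {l m : ℝ} (hl : 0 < l) (hm : 0 < m)
    {G : ℝ × ℝ → ℝ × ℝ} (hG0 : G 0 = 0) {G' : ℝ × ℝ →L[ℝ] ℝ × ℝ} (hG : HasStrictFDerivAt G G' 0)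
    (hG' : ∀ q, G' q = (-l * q.1, m * q.2)) :
    ∃ r > 0, ∃ ε F, IsSaddlePerturbation l m ε F ∧ EqOn F G (Metric.ball 0 r) := by
  set ε : ℝ := min l m / 8 with hε
  have hε0 : 0 < ε := by positivity
  obtain ⟨S, hS, hSl⟩ := hG.approximates_deriv_on_nhds (c := NNReal.mk ε hε0.le) (Or.inr hε0)
  have hlip := hSl.lipschitzOnWith
  obtain ⟨r, hr, hrS⟩ := Metric.mem_nhds_iff.1 hS
  have hl1 : LipschitzOnWith (NNReal.mk ε hε0.le) (fun q => ((G - ⇑G') q).1) S := by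
    simpa using! LipschitzWith.prod_fst.comp_lipschitzOnWith hlip
  have hl2 : LipschitzOnWith (NNReal.mk ε hε0.le) (fun q => ((G - ⇑G') q).2) S := by
    simpa using! LipschitzWith.prod_snd.comp_lipschitzOnWith hlip
  -- Each component of the nonlinear remainder is extended separately: real-valued Lipschitz
  -- functions extend with the same constant, and the maximum norm loses nothing.
  obtain ⟨g₁, hg₁, he₁⟩ := hl1.extend_real
  obtain ⟨g₂, hg₂, he₂⟩ := hl2.extend_real
  have heq : ∀ q ∈ S, (-l * q.1 + g₁ q, m * q.2 + g₂ q) = G q := by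
    intro q hq
    have h1 := he₁ hq
    have h2 := he₂ hq
    simp only [Pi.sub_apply, hG', Prod.fst_sub, Prod.snd_sub] at h1 h2
    exact Prod.ext (by simp only [← h1]; ring) (by simp only [← h2]; ring)
  refine ⟨r, hr, ε, fun q => (-l * q.1 + g₁ q, m * q.2 + g₂ q), ?_, fun q hq => heq q (hrS hq)⟩
  constructor
  · exact hε0.le
  · exact hl
  · exact hm
  · linarith [min_le_left l m]
  · linarith [min_le_right l m]
  · exact (heq 0 (mem_of_mem_nhds hS)).trans hG0
  · intro p q
    have := hg₁.dist_le_mul p q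
    rw [dist_eq_norm, dist_eq_norm, Real.norm_eq_abs] at this
    convert! this using 2; ring
  · intro p q
    have := hg₂.dist_le_mul p q
    rw [dist_eq_norm, dist_eq_norm, Real.norm_eq_abs] at this
    convert! this using 2; ring

theorem IsIntegralCurveOn.congr_field {E : Type*} [NormedAddCommGroup E] [NormedSpace ℝ E]
    {F G : E → E} {x : ℝ → E} {s : Set ℝ} (hx : IsIntegralCurveOn x (fun _ => F) s)
    (h : ∀ t ∈ s, F (x t) = G (x t)) : IsIntegralCurveOn x (fun _ => G) s :=
  fun t ht => by simpa only [← h t ht] using hx t ht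

/-- The local stable curve of a planar saddle in coordinates diagonalizing the linear part. -/
theorem exists_local_stable_curve {l m : ℝ} (hl : 0 < l) (hm : 0 < m)
    {G : ℝ × ℝ → ℝ × ℝ} (hG0 : G 0 = 0) {G' : ℝ × ℝ →L[ℝ] ℝ × ℝ} (hG : HasStrictFDerivAt G G' 0)
    (hG' : ∀ q, G' q = (-l * q.1, m * q.2)) :
    ∃ s : ℝ → ℝ, s 0 = 0 ∧ (∀ a b, |s a - s b| ≤ |a - b| / 2) ∧ ∃ a₀ a₁ : ℝ → ℝ × ℝ,
      (IsIntegralCurveOn a₀ (fun _ => G) (Ici 0) ∧ Tendsto a₀ atTop (𝓝 0) ∧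
        ∀ t ∈ Ici (0 : ℝ), 0 < (a₀ t).1 ∧ (a₀ t).2 = s (a₀ t).1) ∧
      (IsIntegralCurveOn a₁ (fun _ => G) (Ici 0) ∧ Tendsto a₁ atTop (𝓝 0) ∧
        ∀ t ∈ Ici (0 : ℝ), (a₁ t).1 < 0 ∧ (a₁ t).2 = s (a₁ t).1) ∧
      ∀ x : ℝ → ℝ × ℝ, IsIntegralCurveOn x (fun _ => G) (Ici 0) → (∀ t ∈ Ici (0 : ℝ), x t ≠ 0) →
        Tendsto x atTop (𝓝 0) →
        ∃ c : ℝ, (∀ᶠ t in atTop, x t = a₀ (t + c)) ∨ (∀ᶠ t in atTop, x t = a₁ (t + c)) := by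
  obtain ⟨r, hr, ε, F, hF, hFG⟩ := exists_isSaddlePerturbation_eqOn hl hm hG0 hG hG'
  obtain ⟨s, hs0, hs, hgraph, hex⟩ := hF.exists_stable_graph
  -- The solutions over `±u` stay within norm `u < r`, where `F` and `G` agree, so they also solve
  -- the original equation.
  set u := r / 2 with hu
  have hu0 : 0 < u := by positivity
  obtain ⟨a₀, h00, h0F, h0b, h0p, h0l⟩ := hex u hu0.ne'
  obtain ⟨a₁, h10, h1F, h1b, h1p, h1l⟩ := hex (-u) (by linarith)
  rw [abs_of_pos hu0] at h0b
  rw [abs_neg, abs_of_pos hu0] at h1b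
  have hball : ∀ {q : ℝ × ℝ}, ‖q‖ ≤ u → F q = G q := fun hq =>
    hFG (mem_ball_zero_iff.2 (by linarith))
  refine ⟨s, hs0, hs, a₀, a₁,
    ⟨h0F.congr_field fun t ht => hball (h0b t ht), h0l, fun t ht => ⟨?_, hgraph _ h0F ⟨u, h0b⟩ t ht⟩⟩,
    ⟨h1F.congr_field fun t ht => hball (h1b t ht), h1l, fun t ht => ⟨?_, hgraph _ h1F ⟨u, h1b⟩ t ht⟩⟩,
    ?_⟩
  · exact pos_of_mul_pos_left (h0p t ht) hu0.le
  · nlinarith [h1p t ht]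
  · intro x hx hxne hxl
    obtain ⟨T, hT⟩ := eventually_atTop.1
      ((hxl.norm.eventually (gt_mem_nhds (show ‖(0 : ℝ × ℝ)‖ < u by simpa using hu0))).and
        (eventually_ge_atTop 0))
    have hT0 : 0 ≤ T := (hT T le_rfl).2
    have hyb : ∀ t ∈ Ici (0 : ℝ), ‖x (t + T)‖ ≤ u := fun t ht =>
      (hT _ (by linarith [mem_Ici.1 ht])).1.le
    have hy : IsIntegralCurveOn (fun t => x (t + T)) (fun _ => F) (Ici 0) :=
      (hx.shift_Ici hT0).congr_field fun t ht => (hball (hyb t ht)).symm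
    have hys := hgraph _ hy ⟨u, hyb⟩
    have hyle : |(x (0 + T)).1| ≤ u := (norm_fst_le _).trans (hyb 0 self_mem_Ici)
    have hyne : (x (0 + T)).1 ≠ 0 := by
      intro h0
      refine hxne (0 + T) (by simpa using hT0) (Prod.ext h0 ?_)
      rw [hys 0 self_mem_Ici, h0, hs0]; rfl
    have back : ∀ {a : ℝ → ℝ × ℝ}, (∃ c, ∀ t ∈ Ici (0 : ℝ), x (t + T) = a (t + c)) →
        ∃ c, ∀ᶠ t in atTop, x t = a (t + c) := by
      rintro a ⟨c, hc⟩
      refine ⟨c - T, ?_⟩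
      filter_upwards [eventually_ge_atTop T] with t ht
      have := hc (t - T) (by simpa using ht)
      rw [sub_add_cancel] at this
      rw [this]; ring_nf
    rcases lt_or_gt_of_ne hyne with h | h
    · obtain ⟨c, hc⟩ := back (hF.exists_shift_eq h1F hy (hgraph _ h1F ⟨u, h1b⟩)
        (hys 0 self_mem_Ici) h1l (by rw [h10]; nlinarith)
        (by rw [h10, abs_neg, abs_of_pos hu0]; exact hyle))
      exact ⟨c, Or.inr hc⟩
    · obtain ⟨c, hc⟩ := back (hF.exists_shift_eq h0F hy (hgraph _ h0F ⟨u, h0b⟩)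
        (hys 0 self_mem_Ici) h0l (by rw [h00]; positivity)
        (by rw [h00, abs_of_pos hu0]; exact hyle))
      exact ⟨c, Or.inl hc⟩

/-! ### Straightening the stable and unstable curves. -/

/-- Straightening two transversal Lipschitz graphs. -/
theorem exists_homeomorph_straightening {s w : ℝ → ℝ} (hs : ∀ a b, |s a - s b| ≤ |a - b| / 2)
    (hw : ∀ a b, |w a - w b| ≤ |a - b| / 2) :
    ∃ H : ℝ × ℝ ≃ₜ ℝ × ℝ, ∀ q, H q = (q.1 - w q.2, q.2 - s q.1) := by
  let f : ℝ × ℝ → ℝ × ℝ := fun q => (q.1 - w q.2, q.2 - s q.1)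
  -- The map is the identity plus a map of Lipschitz constant `1/2 < 1`, hence a homeomorphism of
  -- the plane.
  have hf : ApproximatesLinearOn f
      ((ContinuousLinearEquiv.refl ℝ (ℝ × ℝ) : (ℝ × ℝ) ≃L[ℝ] (ℝ × ℝ)) : ℝ × ℝ →L[ℝ] ℝ × ℝ) univ
      (1 / 2) := by
    intro p _ q _
    have h1 := hs p.1 q.1
    have h2 := hw p.2 q.2
    have n1 : |p.1 - q.1| ≤ ‖p - q‖ := norm_fst_le (p - q)
    have n2 : |p.2 - q.2| ≤ ‖p - q‖ := norm_snd_le (p - q)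
    have e : f p - f q - (p - q) = (-(w p.2 - w q.2), -(s p.1 - s q.1)) := by
      ext <;> simp [f] <;> ring
    have : ‖f p - f q - (p - q)‖ ≤ ‖p - q‖ / 2 := by
      rw [e, Prod.norm_def]
      refine max_le ?_ ?_ <;> simp only [norm_neg, Real.norm_eq_abs] <;> linarith
    simpa [div_eq_inv_mul] using this
  refine ⟨hf.toHomeomorph _ (Or.inr ?_), fun q => rfl⟩
  have h1 : ‖((ContinuousLinearEquiv.refl ℝ (ℝ × ℝ)).symm : ℝ × ℝ →L[ℝ] ℝ × ℝ)‖₊ = 1 := by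
    ext
    exact ContinuousLinearMap.norm_id
  rw [h1, inv_one]
  exact NNReal.half_lt_self one_ne_zero

/-! ### Time reversal -/

theorem IsIntegralCurveOn.comp_neg_of_neg {E : Type*} [NormedAddCommGroup E] [NormedSpace ℝ E]
    {F G : E → E} {x : ℝ → E} {s t : Set ℝ} (hx : IsIntegralCurveOn x (fun _ => F) s)
    (hst : ∀ r ∈ t, -r ∈ s) (hG : G = -F) : IsIntegralCurveOn (fun r => x (-r)) (fun _ => G) t := by
  intro r hr
  have h := HasDerivWithinAt.scomp r (hx (-r) (hst r hr)) (hasDerivAt_neg r).hasDerivWithinAt hst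
  simpa [hG] using! h

theorem IsIncoming.isOutgoing {f : Plane → Plane} {p : Plane} {x : ℝ → Plane}
    (h : IsIncoming (-f) p x) : IsOutgoing f p fun t => x (-t) :=
  ⟨h.1.comp_neg_of_neg (fun t ht => by simpa using ht) (neg_neg f).symm,
    fun t ht => h.2.1 (-t) (by simpa using ht), h.2.2.comp tendsto_neg_atBot_atTop⟩

theorem IsOutgoing.isIncoming {f : Plane → Plane} {p : Plane} {x : ℝ → Plane}
    (h : IsOutgoing f p x) : IsIncoming (-f) p fun t => x (-t) :=
  ⟨h.1.comp_neg_of_neg (fun t ht => by simpa using ht) rfl,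
    fun t ht => h.2.1 (-t) (by simpa using ht), h.2.2.comp tendsto_neg_atTop_atBot⟩

/-! ### Saddles -/

theorem IsIntegralCurveOn.conj {E E' : Type*} [NormedAddCommGroup E] [NormedSpace ℝ E]
    [NormedAddCommGroup E'] [NormedSpace ℝ E'] {F : E → E} {x : ℝ → E} {s : Set ℝ}
    (hx : IsIntegralCurveOn x (fun _ => F) s) (Φ : E →L[ℝ] E') (c : E) {G : E' → E'}
    (hG : ∀ y, G (Φ (y - c)) = Φ (F y)) :
    IsIntegralCurveOn (fun t => Φ (x t - c)) (fun _ => G) s := by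
  intro t ht
  simp only [hG]
  exact Φ.hasFDerivAt.comp_hasDerivWithinAt t ((hx t ht).sub_const c)

theorem exists_local_stable_curve_plane {l m : ℝ} (hl : 0 < l) (hm : 0 < m) {f : Plane → Plane}
    {p : Plane} (hp : f p = 0) {f' : Plane →L[ℝ] Plane} (hf : HasStrictFDerivAt f f' p)
    (Φ : Plane ≃L[ℝ] ℝ × ℝ) (hΦ : ∀ v, Φ (f' v) = (-l * (Φ v).1, m * (Φ v).2)) :
    ∃ s : ℝ → ℝ, s 0 = 0 ∧ (∀ a b, |s a - s b| ≤ |a - b| / 2) ∧ ∃ a₀ a₁ : ℝ → Plane,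
      IsIncoming f p a₀ ∧ IsIncoming f p a₁ ∧
      (∀ t ∈ Ici (0 : ℝ), 0 < (Φ (a₀ t - p)).1 ∧ (Φ (a₀ t - p)).2 = s (Φ (a₀ t - p)).1) ∧
      (∀ t ∈ Ici (0 : ℝ), (Φ (a₁ t - p)).1 < 0 ∧ (Φ (a₁ t - p)).2 = s (Φ (a₁ t - p)).1) ∧
      ∀ x, IsIncoming f p x →
        ∃ c : ℝ, (∀ᶠ t in atTop, x t = a₀ (t + c)) ∨ (∀ᶠ t in atTop, x t = a₁ (t + c)) := by
  have h1 : HasStrictFDerivAt (fun q : ℝ × ℝ => p + Φ.symm q)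
      (Φ.symm : ℝ × ℝ →L[ℝ] Plane) 0 :=
    Φ.symm.toContinuousLinearMap.hasStrictFDerivAt.const_add p
  have h2 : HasStrictFDerivAt (fun q : ℝ × ℝ => Φ (f (p + Φ.symm q)))
      ((Φ : Plane →L[ℝ] ℝ × ℝ).comp (f'.comp (Φ.symm : ℝ × ℝ →L[ℝ] Plane))) 0 := by
    have hf0 : HasStrictFDerivAt f f' (p + Φ.symm 0) := by simpa using hf
    exact Φ.toContinuousLinearMap.hasStrictFDerivAt.comp 0 (hf0.comp 0 h1)
  obtain ⟨s, hs0, hs, a₀, a₁, ⟨h0c, h0l, h0⟩, ⟨h1c, h1l, h1⟩, huniq⟩ :=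
    exists_local_stable_curve hl hm (by simp [hp]) h2 (fun q => by simp [hΦ])
  have toPlane : ∀ a : ℝ → ℝ × ℝ, IsIntegralCurveOn a (fun _ q => Φ (f (p + Φ.symm q))) (Ici 0) →
      Tendsto a atTop (𝓝 0) → (∀ t ∈ Ici (0 : ℝ), (a t).1 ≠ 0) →
      IsIncoming f p fun t => p + Φ.symm (a t) := by
    intro a ha hal hane
    refine ⟨?_, fun t ht h => ?_, ?_⟩
    · have := ha.conj (Φ.symm : ℝ × ℝ →L[ℝ] Plane) (Φ (-p)) (G := f) (fun y => by
        simp [add_comm])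
      simpa [IsTrajectoryOn, add_comm] using this
    · have h3 : a t = 0 := by simpa using h
      exact hane t ht (by rw [h3]; rfl)
    · have := ((Φ.symm.continuous.tendsto 0).comp hal).const_add p
      simpa using! this
  refine ⟨s, hs0, hs, fun t => p + Φ.symm (a₀ t), fun t => p + Φ.symm (a₁ t),
    toPlane a₀ h0c h0l fun t ht => (h0 t ht).1.ne', toPlane a₁ h1c h1l fun t ht => (h1 t ht).1.ne,
    by simpa using h0, by simpa using h1, fun x hx => ?_⟩
  obtain ⟨c, hc⟩ := huniq (fun t => Φ (x t - p))
    (hx.1.conj (Φ : Plane →L[ℝ] ℝ × ℝ) p (fun y => by simp))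
    (fun t ht h => hx.2.1 t ht (by simpa [sub_eq_zero] using h))
    (by
      have := (Φ.continuous.tendsto (p - p)).comp (hx.2.2.sub_const p)
      simpa [Function.comp_def] using this)
  refine ⟨c, hc.imp (fun h => ?_) (fun h => ?_)⟩ <;>
  · filter_upwards [h] with t ht
    rw [← ht]; simp

/-- The outgoing curves are the incoming ones of `-f`, for which the two coordinates exchange roles.
This gives a graph `v = s u` and a graph `u = w v`, and the homeomorphism `(u - w v, v - s u)`
flattens both. -/
theorem isSaddle_of_diagonalization {l m : ℝ} (hl : 0 < l) (hm : 0 < m) {f : Plane → Plane}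
    {p : Plane} (hp : f p = 0) {f' : Plane →L[ℝ] Plane} (hf : HasStrictFDerivAt f f' p)
    (Φ : Plane ≃L[ℝ] ℝ × ℝ) (hΦ : ∀ v, Φ (f' v) = (-l * (Φ v).1, m * (Φ v).2)) :
    IsSaddle f p := by
  obtain ⟨s, hs0, hs, a₀, a₁, ha₀, ha₁, hA₀, hA₁, hA⟩ :=
    exists_local_stable_curve_plane hl hm hp hf Φ hΦ
  obtain ⟨w, hw0, hw, b₀, b₁, hb₀, hb₁, hB₀, hB₁, hB⟩ :=
    exists_local_stable_curve_plane hm hl (f := -f) (by simp [hp]) hf.neg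
      (Φ.trans (ContinuousLinearEquiv.prodComm ℝ ℝ ℝ)) (fun v => by simp [hΦ])
  simp only [ContinuousLinearEquiv.trans_apply, ContinuousLinearEquiv.prodComm_apply,
    Prod.fst_swap, Prod.snd_swap] at hB₀ hB₁
  obtain ⟨H, hH⟩ := exists_homeomorph_straightening hs hw
  let e : Plane ≃ₜ Plane := (Homeomorph.subRight p).trans
    (Φ.toHomeomorph.trans (H.trans (Φ.toHomeomorph.symm.trans (Φ.toHomeomorph.trans
      ((Homeomorph.finTwoArrow (X := ℝ)).symm.trans (EuclideanSpace.equiv (Fin 2) ℝ).symm.toHomeomorph)))))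
  have he0 : ∀ y, e y 0 = (Φ (y - p)).1 - w (Φ (y - p)).2 := fun y => by
    simp [e, hH]
  have he1 : ∀ y, e y 1 = (Φ (y - p)).2 - s (Φ (y - p)).1 := fun y => by
    simp [e, hH]
  -- On the graph of `s` the first new coordinate is `u - w (s u)`, which thus keeps the sign of
  -- `u`; likewise on the graph of `w`.
  have bound : ∀ g k : ℝ → ℝ, g 0 = 0 → k 0 = 0 → (∀ a b, |g a - g b| ≤ |a - b| / 2) →
      (∀ a b, |k a - k b| ≤ |a - b| / 2) → ∀ u, |g (k u)| ≤ |u| / 4 := by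
    intro g k hg0 hk0 hg hk u
    have h1 := hg (k u) 0
    have h2 := hk u 0
    simp only [hg0, hk0, sub_zero] at h1 h2
    linarith
  refine ⟨hp, a₀, a₁, fun t => b₀ (-t), fun t => b₁ (-t), ha₀, ha₁, hb₀.isOutgoing, hb₁.isOutgoing,
    hA, ?_, e.toOpenPartialHomeomorph, trivial, ?_, ?_, ?_, ?_, ?_⟩
  · intro x hx
    obtain ⟨c, hc⟩ := hB _ hx.isIncoming
    refine ⟨-c, hc.imp (fun h => ?_) (fun h => ?_)⟩ <;>
    · filter_upwards [tendsto_neg_atBot_atTop.eventually h] with t ht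
      rw [neg_neg] at ht
      rw [ht]; ring_nf
  · ext i
    fin_cases i
    · simpa [hw0] using! he0 p
    · simpa [hs0] using! he1 p
  · filter_upwards [eventually_ge_atTop 0] with t ht
    simp only [Homeomorph.toOpenPartialHomeomorph_apply, he0, he1]
    obtain ⟨h1, h2⟩ := hA₀ t ht
    rw [h2]
    have := (abs_le.1 (bound w s hw0 hs0 hw hs (Φ (a₀ t - p)).1)).2
    rw [abs_of_pos h1] at this
    exact ⟨by linarith, sub_self _⟩
  · filter_upwards [eventually_le_atBot 0] with t ht
    simp only [Homeomorph.toOpenPartialHomeomorph_apply, he0, he1]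
    obtain ⟨h1, h2⟩ := hB₀ (-t) (by simpa using ht)
    rw [h2]
    have := (abs_le.1 (bound s w hs0 hw0 hs hw (Φ (b₀ (-t) - p)).2)).2
    rw [abs_of_pos h1] at this
    exact ⟨sub_self _, by linarith⟩
  · filter_upwards [eventually_ge_atTop 0] with t ht
    simp only [Homeomorph.toOpenPartialHomeomorph_apply, he0, he1]
    obtain ⟨h1, h2⟩ := hA₁ t ht
    rw [h2]
    have := (abs_le.1 (bound w s hw0 hs0 hw hs (Φ (a₁ t - p)).1)).1
    rw [abs_of_neg h1] at this
    exact ⟨by linarith, sub_self _⟩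
  · filter_upwards [eventually_le_atBot 0] with t ht
    simp only [Homeomorph.toOpenPartialHomeomorph_apply, he0, he1]
    obtain ⟨h1, h2⟩ := hB₁ (-t) (by simpa using ht)
    rw [h2]
    have := (abs_le.1 (bound s w hs0 hw0 hs hw (Φ (b₁ (-t) - p)).2)).1
    rw [abs_of_neg h1] at this
    exact ⟨sub_self _, by linarith⟩

/-! ### The Jacobian -/

theorem Plane.eq_smul_add_smul (v : Plane) :
    v = v 0 • EuclideanSpace.single 0 1 + v 1 • EuclideanSpace.single 1 1 := by
  ext i
  fin_cases i <;> simp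

theorem fderiv_apply_eq_jacobian (f : Plane → Plane) (x v : Plane) (i : Fin 2) :
    fderiv ℝ f x v i = jacobian f x i 0 * v 0 + jacobian f x i 1 * v 1 := by
  conv_lhs => rw [Plane.eq_smul_add_smul v]
  simp only [map_add, map_smul, PiLp.add_apply, PiLp.smul_apply, smul_eq_mul, jacobian,
    Matrix.of_apply]
  ring

theorem isSaddle_of_det_neg {f : Plane → Plane} (hf : ContDiff ℝ 1 f) {p : Plane} (hp : f p = 0)
    (hdet : (jacobian f p).det < 0) : IsSaddle f p := by
  have hstrict := (hf.contDiffAt (x := p)).hasStrictFDerivAt one_ne_zero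
  set A := jacobian f p with hA
  rw [Matrix.det_fin_two] at hdet
  set τ := A 0 0 + A 1 1 with hτ
  set D := A 0 0 * A 1 1 - A 0 1 * A 1 0 with hD
  set R := Real.sqrt (τ ^ 2 - 4 * D) with hR
  have hR2 : R ^ 2 = τ ^ 2 - 4 * D := Real.sq_sqrt (by nlinarith [sq_nonneg τ])
  have hRτ : |τ| < R := by
    refine Real.lt_sqrt_of_sq_lt ?_
    rw [sq_abs]; linarith
  obtain ⟨hRτ1, hRτ2⟩ := abs_lt.1 hRτ
  -- Left eigenvectors are used because, as linear functionals, they are directly the coordinates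
  -- that diagonalize `A`. The eigenvalues `(τ ± R) / 2` have opposite signs as `|τ| < R`.
  have row : ∀ κ : ℝ, κ ^ 2 - τ * κ + D = 0 → ∃ a b : ℝ, (a ≠ 0 ∨ b ≠ 0) ∧
      a * A 0 0 + b * A 1 0 = κ * a ∧ a * A 0 1 + b * A 1 1 = κ * b := by
    intro κ hκ
    have hdet0 : (A - κ • (1 : Matrix (Fin 2) (Fin 2) ℝ)).det = 0 := by
      rw [Matrix.det_fin_two]
      simp
      linear_combination hκ
    obtain ⟨v, hv, hv0⟩ := Matrix.exists_vecMul_eq_zero_iff.2 hdet0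
    refine ⟨v 0, v 1, ?_, ?_, ?_⟩
    · by_contra! h
      exact hv (funext fun i => by fin_cases i <;> simp [h])
    · have := congrFun hv0 0
      simp [Matrix.vecMul, dotProduct, Fin.sum_univ_two] at this
      linear_combination this
    · have := congrFun hv0 1
      simp [Matrix.vecMul, dotProduct, Fin.sum_univ_two] at this
      linear_combination this
  obtain ⟨a, b, hab, e1, e2⟩ := row (-((R - τ) / 2)) (by linear_combination hR2 / 4)
  obtain ⟨c, d, hcd, e3, e4⟩ := row ((R + τ) / 2) (by linear_combination hR2 / 4)
  have hne : a * d - b * c ≠ 0 := by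
    intro h0
    have hR0 : R ≠ 0 := by have := abs_nonneg τ; linarith
    have k1 : R * a * c = 0 := by
      linear_combination c * e1 - a * e3 + A 1 0 * h0
    have k2 : R * b * d = 0 := by
      linear_combination d * e2 - b * e4 - A 0 1 * h0
    have k3 : a * c = 0 := by simpa [hR0, mul_assoc] using k1
    have k4 : b * d = 0 := by simpa [hR0, mul_assoc] using k2
    rcases mul_eq_zero.1 k3 with ha | hc
    · have hb : b ≠ 0 := hab.resolve_left (by simp [ha])
      have hd : d = 0 := (mul_eq_zero.1 k4).resolve_left hb
      have hc : c = 0 := by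
        rw [ha, hd] at h0; simpa [hb] using h0
      simp [hc, hd] at hcd
    · have hd : d ≠ 0 := hcd.resolve_left (by simp [hc])
      have hb : b = 0 := (mul_eq_zero.1 k4).resolve_right hd
      have ha : a = 0 := by
        rw [hc, hb] at h0; simpa [hd] using h0
      simp [ha, hb] at hab
  let E0 : Plane →L[ℝ] ℝ := EuclideanSpace.proj 0
  let E1 : Plane →L[ℝ] ℝ := EuclideanSpace.proj 1
  let L : Plane →L[ℝ] ℝ × ℝ := (a • E0 + b • E1).prod (c • E0 + d • E1)
  have hL : ∀ v, L v = (a * v 0 + b * v 1, c * v 0 + d * v 1) := fun v => rfl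
  have hinj : Function.Injective L := by
    rw [injective_iff_map_eq_zero]
    intro v hv
    rw [hL, Prod.mk_eq_zero] at hv
    obtain ⟨h1, h2⟩ := hv
    have k1 : (a * d - b * c) * v 0 = 0 := by linear_combination d * h1 - b * h2
    have k2 : (a * d - b * c) * v 1 = 0 := by linear_combination a * h2 - c * h1
    ext i
    fin_cases i
    · simpa [hne] using k1
    · simpa [hne] using k2
  let Φ : Plane ≃L[ℝ] ℝ × ℝ := (LinearEquiv.ofInjectiveOfFinrankEq (L : Plane →ₗ[ℝ] ℝ × ℝ) hinj
    (by simp)).toContinuousLinearEquiv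
  have hΦ : ∀ v, Φ v = L v := fun v => rfl
  refine isSaddle_of_diagonalization (l := (R - τ) / 2) (m := (R + τ) / 2) (by linarith)
    (by linarith) hp hstrict Φ fun v => ?_
  rw [hΦ, hΦ, hL, hL, fderiv_apply_eq_jacobian, fderiv_apply_eq_jacobian, ← hA]
  refine Prod.ext ?_ ?_ <;> simp only
  · linear_combination v 0 * e1 + v 1 * e2
  · linear_combination v 0 * e3 + v 1 * e4

/-! ### Attracting equilibria -/

/-- Positive semidefinite forms built from the adjugate: the key estimate for the Lyapunov
function `D |v|² + |adj(A) v|²`. -/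
theorem lyapunov_estimate {a b c d D M η : ℝ} (hD : 0 < D) (hDdef : D = a * d - b * c)
    (hM : M = D + (a ^ 2 + b ^ 2 + c ^ 2 + d ^ 2)) (hη : 0 < η) {v₀ v₁ e₀ e₁ : ℝ}
    (he : e₀ ^ 2 + e₁ ^ 2 ≤ η ^ 2 * (v₀ ^ 2 + v₁ ^ 2)) :
    2 * (D * (v₀ * (a * v₀ + b * v₁ + e₀) + v₁ * (c * v₀ + d * v₁ + e₁)) +
      (d * v₀ - b * v₁) * (d * (a * v₀ + b * v₁ + e₀) - b * (c * v₀ + d * v₁ + e₁)) +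
      (a * v₁ - c * v₀) * (a * (c * v₀ + d * v₁ + e₁) - c * (a * v₀ + b * v₁ + e₀))) ≤
    (2 * (D * (a + d)) + 2 * (η * M)) * (v₀ ^ 2 + v₁ ^ 2) := by
  have upper : ∀ x y : ℝ, D * (x ^ 2 + y ^ 2) + (d * x - b * y) ^ 2 + (a * y - c * x) ^ 2 ≤
      M * (x ^ 2 + y ^ 2) := fun x y => by
    rw [hM]
    nlinarith [sq_nonneg (d * y + b * x), sq_nonneg (a * x + c * y)]
  have hM0 : 0 ≤ M := by rw [hM]; positivity
  have h1 := upper v₀ v₁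
  have h2 := upper e₀ e₁
  have h3 := mul_le_mul_of_nonneg_left he hM0
  -- The positive semidefinite form at `η v - e` yields the Cauchy–Schwarz bound on the cross term
  -- `P`.
  have h4 : 0 ≤ D * ((η * v₀ - e₀) ^ 2 + (η * v₁ - e₁) ^ 2) +
      (d * (η * v₀ - e₀) - b * (η * v₁ - e₁)) ^ 2 +
      (a * (η * v₁ - e₁) - c * (η * v₀ - e₀)) ^ 2 := by positivity
  set P := D * (v₀ * e₀ + v₁ * e₁) + (d * v₀ - b * v₁) * (d * e₀ - b * e₁) +
    (a * v₁ - c * v₀) * (a * e₁ - c * e₀) with hP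
  have h5 : 2 * η * P ≤ 2 * η * (η * M * (v₀ ^ 2 + v₁ ^ 2)) := by
    have h6 := mul_le_mul_of_nonneg_left h1 (sq_nonneg η)
    rw [hP]
    linarith
  have h7 : P ≤ η * M * (v₀ ^ 2 + v₁ ^ 2) := le_of_mul_le_mul_left h5 (by positivity)
  -- Since `adj(A) A = D` and `A + adj(A) = tr A`, the linear part contributes exactly `2 D tr(A)
  -- |v|²`.
  have h8 : 2 * (D * (v₀ * (a * v₀ + b * v₁ + e₀) + v₁ * (c * v₀ + d * v₁ + e₁)) +
      (d * v₀ - b * v₁) * (d * (a * v₀ + b * v₁ + e₀) - b * (c * v₀ + d * v₁ + e₁)) +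
      (a * v₁ - c * v₀) * (a * (c * v₀ + d * v₁ + e₁) - c * (a * v₀ + b * v₁ + e₀))) =
      2 * (D * (a + d)) * (v₀ ^ 2 + v₁ ^ 2) + 2 * P := by
    rw [hP, hDdef]; ring
  rw [h8]
  linarith

theorem HasDerivWithinAt.plane_apply {x : ℝ → Plane} {v : Plane} {s : Set ℝ} {t : ℝ}
    (h : HasDerivWithinAt x v s t) (i : Fin 2) : HasDerivWithinAt (fun t => x t i) (v i) s t :=
  (EuclideanSpace.proj i : Plane →L[ℝ] ℝ).hasFDerivAt.comp_hasDerivWithinAt t h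

/-- Solutions starting close to an equilibrium with Jacobian of positive determinant and negative
trace decay exponentially. -/
theorem exists_exponential_decay {f : Plane → Plane} {p : Plane} (hf : DifferentiableAt ℝ f p)
    (hp : f p = 0) (hdet : 0 < (jacobian f p).det) (htr : (jacobian f p).trace < 0) :
    ∃ κ > 0, ∃ c > 0, ∃ μ₀ > 0, ∀ μ, 0 < μ → μ < μ₀ → ∀ x : ℝ → Plane,
      IsTrajectoryOn f x (Ici 0) → ‖x 0 - p‖ ≤ μ →
        ∀ t ∈ Ici (0 : ℝ), ‖x t - p‖ ≤ κ * μ * Real.exp (-c * t) := by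
  rw [Matrix.det_fin_two] at hdet
  rw [Matrix.trace_fin_two] at htr
  obtain ⟨a, ha⟩ : ∃ a, a = jacobian f p 0 0 := ⟨_, rfl⟩
  obtain ⟨b, hb⟩ : ∃ b, b = jacobian f p 0 1 := ⟨_, rfl⟩
  obtain ⟨c, hc⟩ : ∃ c, c = jacobian f p 1 0 := ⟨_, rfl⟩
  obtain ⟨d, hd⟩ : ∃ d, d = jacobian f p 1 1 := ⟨_, rfl⟩
  have hder0 : ∀ v : Plane, fderiv ℝ f p v 0 = a * v 0 + b * v 1 := fun v => by
    rw [fderiv_apply_eq_jacobian, ha, hb]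
  have hder1 : ∀ v : Plane, fderiv ℝ f p v 1 = c * v 0 + d * v 1 := fun v => by
    rw [fderiv_apply_eq_jacobian, hc, hd]
  rw [← ha, ← hb, ← hc, ← hd] at hdet
  rw [← ha, ← hd] at htr
  set D := a * d - b * c with hD
  set M := D + (a ^ 2 + b ^ 2 + c ^ 2 + d ^ 2) with hM
  have hM0 : 0 < M := by positivity
  set σ := -(D * (a + d)) with hσ
  have hσ0 : 0 < σ := neg_pos.2 (mul_neg_of_pos_of_neg hdet htr)
  -- With this `η` the error uses up half of the linear decay: `-2σ + 2ηM = -σ`.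
  set η := σ / (2 * M) with hη
  have hη0 : 0 < η := by positivity
  obtain ⟨r, hr, hrb⟩ := Metric.eventually_nhds_iff_ball.1 (hf.hasFDerivAt.isLittleO.def hη0)
  let V : Plane → ℝ := fun v =>
    D * (v 0 ^ 2 + v 1 ^ 2) + (d * v 0 - b * v 1) ^ 2 + (a * v 1 - c * v 0) ^ 2
  have hVlow : ∀ v, D * ‖v‖ ^ 2 ≤ V v := fun v => by
    rw [EuclideanSpace.real_norm_sq_eq, Fin.sum_univ_two]
    simp only [V]
    nlinarith [sq_nonneg (d * v 0 - b * v 1), sq_nonneg (a * v 1 - c * v 0)]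
  have hVup : ∀ v, V v ≤ M * ‖v‖ ^ 2 := fun v => by
    rw [EuclideanSpace.real_norm_sq_eq, Fin.sum_univ_two]
    simp only [V, hM]
    nlinarith [sq_nonneg (d * v 1 + b * v 0), sq_nonneg (a * v 0 + c * v 1)]
  let V' : Plane → Plane → ℝ := fun v w =>
    2 * (D * (v 0 * w 0 + v 1 * w 1) + (d * v 0 - b * v 1) * (d * w 0 - b * w 1) +
      (a * v 1 - c * v 0) * (a * w 1 - c * w 0))
  have hV' : ∀ y ∈ Metric.ball p r, V' (y - p) (f y) ≤ -(σ / M) * V (y - p) := by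
    intro y hy
    have h1 := hrb y hy
    rw [hp, sub_zero] at h1
    set v := y - p
    set e := f y - fderiv ℝ f p v
    have h2 := pow_le_pow_left₀ (norm_nonneg _) h1 2
    rw [mul_pow, EuclideanSpace.real_norm_sq_eq, EuclideanSpace.real_norm_sq_eq, Fin.sum_univ_two,
      Fin.sum_univ_two] at h2
    have h3 := lyapunov_estimate hdet hD hM hη0 h2
    have e0 : f y 0 = a * v 0 + b * v 1 + e 0 := by
      have : e 0 = f y 0 - fderiv ℝ f p v 0 := rfl
      rw [this, hder0]; ring
    have e1 : f y 1 = c * v 0 + d * v 1 + e 1 := by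
      have : e 1 = f y 1 - fderiv ℝ f p v 1 := rfl
      rw [this, hder1]; ring
    have h4 : 2 * (D * (a + d)) + 2 * (η * M) = -σ := by
      rw [hη, hσ]; field_simp; ring
    rw [h4] at h3
    have h5 : V' v (f y) ≤ -σ * (v 0 ^ 2 + v 1 ^ 2) := by
      simp only [V', e0, e1]; exact h3
    have h6 := hVup v
    rw [EuclideanSpace.real_norm_sq_eq, Fin.sum_univ_two] at h6
    have h7 := mul_le_mul_of_nonneg_left h6 (div_pos hσ0 hM0).le
    have h8 : σ / M * (M * (v 0 ^ 2 + v 1 ^ 2)) = σ * (v 0 ^ 2 + v 1 ^ 2) := by field_simp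
    linarith
  set κ := Real.sqrt (M / D) with hκ
  have hκ0 : 0 < κ := Real.sqrt_pos.2 (by positivity)
  have hκ2 : κ ^ 2 = M / D := Real.sq_sqrt (by positivity)
  refine ⟨κ, hκ0, σ / M / 4, by positivity, r / κ, by positivity, ?_⟩
  intro μ hμ hμ0 x hx hx0 T hT
  have hκμ : κ * μ < r := by rwa [lt_div_iff₀' hκ0] at hμ0
  -- The barrier decays at half the rate of `V`, so the derivative comparison is strict at contact.
  -- At contact it also bounds the distance by `κ * μ < r`, where the estimate for `V'` is valid.
  -- The square root then halves the rate again.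
  let B : ℝ → ℝ := fun t => M * μ ^ 2 * Real.exp (-(σ / M / 2) * t)
  have hBle : ∀ t, V (x t - p) ≤ B t →
      ‖x t - p‖ ^ 2 ≤ (κ * μ) ^ 2 * Real.exp (-(σ / M / 2) * t) := by
    intro t ht
    have h1 := (hVlow (x t - p)).trans ht
    rw [mul_pow, hκ2]
    have h2 : M / D * μ ^ 2 * Real.exp (-(σ / M / 2) * t) = B t / D := by simp only [B]; ring
    rw [h2, le_div_iff₀' hdet]
    exact h1
  have hVd : ∀ t ∈ Ici (0 : ℝ),
      HasDerivWithinAt (fun t => V (x t - p)) (V' (x t - p) (f (x t))) (Ici 0) t := by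
    intro t ht
    have h := (hx t ht).sub_const p
    have h0 := h.plane_apply 0
    have h1 := h.plane_apply 1
    convert! (((h0.pow 2).add (h1.pow 2)).const_mul D).add
      (((h0.const_mul d).sub (h1.const_mul b)).pow 2) |>.add
      (((h1.const_mul a).sub (h0.const_mul c)).pow 2) using 1
    simp only [V']
    norm_num
    ring
  have key : V (x T - p) ≤ B T := by
    refine image_le_of_deriv_right_lt_deriv_boundary (f := fun t => V (x t - p))
      (f' := fun t => V' (x t - p) (f (x t))) (a := 0) (b := T) (B := B)
      (B' := fun t => -(σ / M / 2) * B t)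
      (fun t ht => (hVd t ht.1).continuousWithinAt.mono Icc_subset_Ici_self)
      (fun t ht => (hVd t ht.1).mono (Ici_subset_Ici.2 ht.1)) ?_ ?_ ?_ ⟨hT, le_rfl⟩
    · refine (hVup _).trans ?_
      simp only [B, mul_zero, Real.exp_zero, mul_one]
      gcongr
    · intro t
      have h2 : HasDerivAt (fun t : ℝ => Real.exp (-(σ / M / 2) * t))
          (Real.exp (-(σ / M / 2) * t) * (-(σ / M / 2))) t := by
        simpa using ((hasDerivAt_id t).const_mul (-(σ / M / 2))).exp
      convert! h2.const_mul (M * μ ^ 2) using 1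
      simp only [B]; ring
    · intro t ht hVB
      have hB0 : 0 < B t := by positivity
      have h1 := hBle t hVB.le
      have h2 : ‖x t - p‖ ^ 2 ≤ (κ * μ) ^ 2 := h1.trans (mul_le_of_le_one_right (sq_nonneg _) (by
        rw [Real.exp_le_one_iff]
        have : 0 < σ / M / 2 := by positivity
        nlinarith [ht.1]))
      have h3 : ‖x t - p‖ ≤ κ * μ := (sq_le_sq₀ (norm_nonneg _) (by positivity)).1 h2
      have h4 := hV' (x t) (by rw [mem_ball_iff_norm]; linarith)
      rw [hVB] at h4
      have h5 : 0 < σ / M * B t := by positivity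
      linarith
  have h1 := hBle T key
  refine (sq_le_sq₀ (norm_nonneg _) (by positivity)).1 (h1.trans_eq ?_)
  rw [mul_pow (κ * μ), ← Real.exp_nat_mul]
  push_cast
  ring_nf

theorem tendsto_exp_neg_mul_atTop {c : ℝ} (hc : 0 < c) :
    Tendsto (fun t => Real.exp (-c * t)) atTop (𝓝 0) :=
  Real.tendsto_exp_atBot.comp (tendsto_id.const_mul_atTop_of_neg (neg_lt_zero.2 hc))

/-- A cutoff makes the field bounded and globally Lipschitz, so its solutions are global.
Exponential decay keeps those starting near `p` in the unit ball, where the cutoff changes nothing.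
-/
theorem exists_trajectory_of_near {f : Plane → Plane} (hf : ContDiff ℝ 1 f) {p : Plane}
    (hp : f p = 0) (hdet : 0 < (jacobian f p).det) (htr : (jacobian f p).trace < 0) :
    ∃ δ > 0, ∀ x₀ ∈ Metric.ball p δ, ∃ x : ℝ → Plane, x 0 = x₀ ∧ IsTrajectoryOn f x (Ici 0) := by
  let β : ContDiffBump p := ⟨1, 2, one_pos, one_lt_two⟩
  let F : Plane → Plane := fun x => β x • f x
  have hFc : ContDiff ℝ 1 F := β.contDiff.smul hf
  have hFs : HasCompactSupport F := β.hasCompactSupport.smul_right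
  obtain ⟨K, hK⟩ := hFc.lipschitzWith_of_hasCompactSupport hFs one_ne_zero
  obtain ⟨M, hM⟩ := hFs.exists_bound_of_continuous hFc.continuous
  have hFf : ∀ x ∈ Metric.closedBall p 1, F x = f x := fun x hx => by
    simp only [F, β.one_of_mem_closedBall hx, one_smul]
  have hnear : F =ᶠ[𝓝 p] f :=
    eventually_of_mem (Metric.closedBall_mem_nhds p one_pos) hFf
  have hjac : jacobian F p = jacobian f p := by
    unfold jacobian; rw [hnear.fderiv_eq]
  rw [← hjac] at hdet htr
  obtain ⟨κ, hκ, c, hc, μ₀, hμ₀, H⟩ := exists_exponential_decay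
    (hFc.differentiable one_ne_zero p) (hnear.eq_of_nhds.trans hp) hdet htr
  have hδ : 0 < min (μ₀ / 2) (1 / κ) := by positivity
  refine ⟨_, hδ, fun x₀ hx₀ => ?_⟩
  obtain ⟨x, hx0, hx⟩ := exists_integralCurve_of_bounded hK (M := M.toNNReal)
    (fun y => (hM y).trans (Real.le_coe_toNNReal M)) x₀
  have hxF : IsTrajectoryOn F x (Ici 0) := fun t _ => (hx t).hasDerivWithinAt
  refine ⟨x, hx0, IsIntegralCurveOn.congr_field hxF fun t ht => hFf _ ?_⟩
  have h1 := H _ hδ (by linarith [min_le_left (μ₀ / 2) (1 / κ)]) x hxF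
    (by rw [hx0, ← dist_eq_norm]; exact (Metric.mem_ball.1 hx₀).le) t ht
  rw [mem_closedBall_iff_norm]
  refine h1.trans ?_
  have h2 : Real.exp (-c * t) ≤ 1 := by
    rw [Real.exp_le_one_iff]; nlinarith [mem_Ici.1 ht]
  have h3 : κ * min (μ₀ / 2) (1 / κ) ≤ 1 := by
    calc κ * min (μ₀ / 2) (1 / κ) ≤ κ * (1 / κ) := by gcongr; exact min_le_right _ _
      _ = 1 := by field_simp
  calc _ ≤ κ * min (μ₀ / 2) (1 / κ) * 1 := by gcongr
    _ ≤ 1 := by linarith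

theorem isAttracting_of_det_pos_of_trace_neg {f : Plane → Plane} (hf : ContDiff ℝ 1 f) {p : Plane}
    (hp : f p = 0) (hdet : 0 < (jacobian f p).det) (htr : (jacobian f p).trace < 0) :
    IsAttracting f p := by
  obtain ⟨δ₀, hδ₀, hex⟩ := exists_trajectory_of_near hf hp hdet htr
  obtain ⟨κ, hκ, c, hc, μ₀, hμ₀, H⟩ := exists_exponential_decay
    (hf.differentiable one_ne_zero p) hp hdet htr
  refine ⟨hp, fun ε hε => ?_⟩
  have hμ : 0 < min (μ₀ / 2) (ε / (2 * κ)) := by positivity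
  refine ⟨min δ₀ (min (μ₀ / 2) (ε / (2 * κ))), by positivity, fun x₀ hx₀ => ?_⟩
  have hx₀' := Metric.mem_ball.1 hx₀
  refine ⟨hex x₀ (Metric.mem_ball.2 (hx₀'.trans_le (min_le_left _ _))), fun x hx0 hx => ?_⟩
  have h1 := H _ hμ (by linarith [min_le_left (μ₀ / 2) (ε / (2 * κ))]) x hx
    (by rw [hx0, ← dist_eq_norm]; exact (hx₀'.trans_le (min_le_right _ _)).le)
  constructor
  · intro t ht
    rw [mem_ball_iff_norm]
    have h2 : Real.exp (-c * t) ≤ 1 := by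
      rw [Real.exp_le_one_iff]; nlinarith [mem_Ici.1 ht]
    calc ‖x t - p‖ ≤ κ * min (μ₀ / 2) (ε / (2 * κ)) * Real.exp (-c * t) := h1 t ht
      _ ≤ κ * (ε / (2 * κ)) * 1 := by gcongr; exact min_le_right _ _
      _ = ε / 2 := by field_simp
      _ < ε := by linarith
  · rw [tendsto_iff_norm_sub_tendsto_zero]
    refine squeeze_zero' (Eventually.of_forall fun t => norm_nonneg _)
      ((eventually_ge_atTop 0).mono h1) ?_
    simpa using (tendsto_exp_neg_mul_atTop hc).const_mul (κ * min (μ₀ / 2) (ε / (2 * κ)))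

theorem IsIncoming.exponential_decay {f : Plane → Plane} (hf : ContDiff ℝ 1 f) {p : Plane}
    (hp : f p = 0) (hdet : 0 < (jacobian f p).det) (htr : (jacobian f p).trace < 0)
    {x : ℝ → Plane} (hx : IsIncoming f p x) :
    ∃ C > 0, ∃ c > 0, ∀ᶠ t in atTop, ‖x t - p‖ ≤ C * Real.exp (-c * t) := by
  obtain ⟨κ, hκ, c, hc, μ₀, hμ₀, H⟩ := exists_exponential_decay
    (hf.differentiable one_ne_zero p) hp hdet htr
  have h1 : ∀ᶠ t in atTop, ‖x t - p‖ < μ₀ / 2 := by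
    have := hx.2.2.eventually (Metric.ball_mem_nhds p (half_pos hμ₀))
    filter_upwards [this] with t ht
    exact mem_ball_iff_norm.1 ht
  obtain ⟨T, hT, hT0⟩ := (h1.and (eventually_ge_atTop 0)).exists
  have h2 := H (μ₀ / 2) (by positivity) (by linarith) (fun t => x (t + T))
    (IsIntegralCurveOn.shift_Ici hx.1 hT0) (by simpa using hT.le)
  refine ⟨κ * (μ₀ / 2) * Real.exp (c * T), by positivity, c, hc, ?_⟩
  filter_upwards [eventually_ge_atTop T] with t ht
  have h3 := h2 (t - T) (by simpa using ht)
  simp only [sub_add_cancel] at h3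
  rw [mul_assoc _ (Real.exp (c * T)), ← Real.exp_add]
  convert h3 using 3
  ring

/-! ### The angle of a nonvanishing curve -/

/-- A nonvanishing `C¹` curve in `ℂ` on `[0, ∞)` has a `C¹` logarithm. -/
theorem exists_log_curve {z z' : ℝ → ℂ}
    (hz : ∀ t ∈ Ici (0 : ℝ), HasDerivWithinAt z (z' t) (Ici 0) t) (hz' : ContinuousOn z' (Ici 0))
    (hne : ∀ t ∈ Ici (0 : ℝ), z t ≠ 0) :
    ∃ L : ℝ → ℂ, (∀ t ∈ Ici (0 : ℝ), HasDerivWithinAt L (z' t / z t) (Ici 0) t) ∧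
      ∀ t ∈ Ici (0 : ℝ), z t = Complex.exp (L t) := by
  have hzc : ContinuousOn z (Ici 0) := fun t ht => (hz t ht).continuousWithinAt
  have hw : ContinuousOn (fun t => z' t / z t) (Ici 0) := hz'.div hzc hne
  -- Freezing the integrand for `t < 0` makes it continuous on the whole line, so its primitive is
  -- differentiable at `0` too.
  have hwe : Continuous fun t : ℝ => z' (max t 0) / z (max t 0) :=
    hw.comp_continuous (continuous_id.max continuous_const) fun t => mem_Ici.2 (le_max_right _ _)
  have hL : ∀ t ∈ Ici (0 : ℝ), HasDerivWithinAt
      (fun t => Complex.log (z 0) + ∫ s in (0 : ℝ)..t, z' (max s 0) / z (max s 0))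
      (z' t / z t) (Ici 0) t := by
    intro t ht
    have := (intervalIntegral.integral_hasDerivAt_right (hwe.intervalIntegrable 0 t)
      (hwe.stronglyMeasurableAtFilter _ _) hwe.continuousAt).const_add (Complex.log (z 0))
    rw [max_eq_left (mem_Ici.1 ht)] at this
    exact this.hasDerivWithinAt
  refine ⟨_, hL, fun T hT => ?_⟩
  set L : ℝ → ℂ := fun t => Complex.log (z 0) + ∫ s in (0 : ℝ)..t, z' (max s 0) / z (max s 0)
    with hLdef
  have hN : ∀ t ∈ Ici (0 : ℝ), HasDerivWithinAt (fun t => z t * Complex.exp (-L t)) 0 (Ici 0) t := by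
    intro t ht
    convert! (hz t ht).mul (hL t ht).neg.cexp using 1
    have := hne t ht
    field_simp
    ring
  have hconst := constant_of_has_deriv_right_zero (a := 0) (b := T)
    (fun t ht => (hN t ht.1).continuousWithinAt.mono Icc_subset_Ici_self)
    (fun t ht => (hN t ht.1).mono (Ici_subset_Ici.2 ht.1)) T ⟨hT, le_rfl⟩
  have hL0 : L 0 = Complex.log (z 0) := by simp [hLdef]
  rw [hL0, Complex.exp_neg, Complex.exp_neg, Complex.exp_log (hne 0 self_mem_Ici),
    mul_inv_cancel₀ (hne 0 self_mem_Ici)] at hconst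
  exact (div_eq_one_iff_eq (Complex.exp_ne_zero _)).1 (by rw [div_eq_mul_inv]; exact hconst)

/-- The angle is the imaginary part of a logarithm of `y` viewed as a complex curve. -/
theorem exists_angle {y y' : ℝ → Plane}
    (hy : ∀ t ∈ Ici (0 : ℝ), HasDerivWithinAt y (y' t) (Ici 0) t) (hy' : ContinuousOn y' (Ici 0))
    (hne : ∀ t ∈ Ici (0 : ℝ), y t ≠ 0) :
    ∃ θ : ℝ → ℝ, (∀ t ∈ Ici (0 : ℝ),
      HasDerivWithinAt θ ((y t 0 * y' t 1 - y t 1 * y' t 0) / ‖y t‖ ^ 2) (Ici 0) t) ∧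
      ∀ t ∈ Ici (0 : ℝ), y t 0 = ‖y t‖ * Real.cos (θ t) ∧ y t 1 = ‖y t‖ * Real.sin (θ t) := by
  have hz : ∀ t ∈ Ici (0 : ℝ), HasDerivWithinAt (fun t => (⟨y t 0, y t 1⟩ : ℂ))
      (⟨y' t 0, y' t 1⟩ : ℂ) (Ici 0) t := by
    intro t ht
    have h := ((hy t ht).plane_apply 0).ofReal_comp.add
      (((hy t ht).plane_apply 1).ofReal_comp.mul_const Complex.I)
    simp only [Complex.mk_eq_add_mul_I]
    exact h
  have hz' : ContinuousOn (fun t => (⟨y' t 0, y' t 1⟩ : ℂ)) (Ici 0) := by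
    simp only [Complex.mk_eq_add_mul_I]
    fun_prop
  have hnez : ∀ t ∈ Ici (0 : ℝ), (⟨y t 0, y t 1⟩ : ℂ) ≠ 0 := by
    intro t ht h
    refine hne t ht ?_
    have h0 := congrArg Complex.re h
    have h1 := congrArg Complex.im h
    ext i
    fin_cases i
    · simpa using h0
    · simpa using h1
  obtain ⟨L, hL, hexp⟩ := exists_log_curve hz hz' hnez
  have hsq : ∀ t, ‖y t‖ ^ 2 = y t 0 * y t 0 + y t 1 * y t 1 := fun t => by
    rw [EuclideanSpace.real_norm_sq_eq, Fin.sum_univ_two]; ring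
  refine ⟨fun t => (L t).im, fun t ht => ?_, fun t ht => ?_⟩
  · convert! Complex.imCLM.hasFDerivAt.comp_hasDerivWithinAt t (hL t ht) using 1
    rw [Complex.imCLM_apply, Complex.div_im, hsq]
    simp only [Complex.normSq_mk]
    ring
  · have h0 := congrArg Complex.re (hexp t ht)
    have h1 := congrArg Complex.im (hexp t ht)
    simp only [Complex.exp_re, Complex.exp_im] at h0 h1
    have hn : ‖y t‖ = Real.exp (L t).re := by
      refine (sq_eq_sq₀ (norm_nonneg _) (Real.exp_pos _).le).1 ?_
      rw [hsq, h0, h1]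
      linear_combination Real.exp (L t).re ^ 2 * Real.sin_sq_add_cos_sq (L t).im
    rw [hn]
    exact ⟨h0, h1⟩

/-! ### Scalar equations for the angle -/

theorem le_const_of_barrier {ψ v : ℝ → ℝ} {T m : ℝ} (hT : 0 ≤ T)
    (hψ : ∀ t ∈ Ici (0 : ℝ), HasDerivWithinAt ψ (v t) (Ici 0) t)
    (hb : ∀ t ≥ T, ψ t = m → v t < 0) (h0 : ψ T ≤ m) : ∀ t ≥ T, ψ t ≤ m := by
  intro t ht
  exact image_le_of_deriv_right_lt_deriv_boundary (f := ψ) (f' := v) (a := T) (b := t)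
    (B := fun _ => m) (B' := fun _ => 0)
    (fun s hs => (hψ s (hT.trans hs.1)).continuousWithinAt.mono
      (Icc_subset_Ici_self.trans (Ici_subset_Ici.2 hT)))
    (fun s hs => (hψ s (hT.trans hs.1)).mono (Ici_subset_Ici.2 (hT.trans hs.1)))
    h0 (fun s => hasDerivAt_const s m) (fun s hs h => hb s hs.1 h) ⟨ht, le_rfl⟩

theorem tendsto_atTop_of_deriv_ge {θ v : ℝ → ℝ}
    (hθ : ∀ t ∈ Ici (0 : ℝ), HasDerivWithinAt θ (v t) (Ici 0) t) {k : ℝ} (hk : 0 < k)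
    (hv : ∀ᶠ t in atTop, k ≤ v t) : Tendsto θ atTop atTop := by
  obtain ⟨T, hT⟩ := eventually_atTop.1 (hv.and (eventually_ge_atTop 0))
  have hT0 := (hT T le_rfl).2
  have h : ∀ t ≥ T, θ T + k * (t - T) ≤ θ t := by
    intro t ht
    refine image_le_of_deriv_right_le_deriv_boundary (f := fun t => θ T + k * (t - T))
      (f' := fun _ => k) (a := T) (b := t) (B := θ) (B' := v) (by fun_prop) (fun s _ => ?_) (by simp)
      (fun s hs => (hθ s (hT s hs.1).2).continuousWithinAt.mono
        (Icc_subset_Ici_self.trans (Ici_subset_Ici.2 hT0)))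
      (fun s hs => (hθ s (hT s hs.1).2).mono (Ici_subset_Ici.2 (hT s hs.1).2))
      (fun s hs => (hT s hs.1).1) ⟨ht, le_rfl⟩
    have := ((((hasDerivAt_id s).sub_const T).const_mul k).const_add (θ T)).hasDerivWithinAt
      (s := Ici s)
    simpa using! this
  refine tendsto_atTop_mono' _ ((eventually_ge_atTop T).mono h) ?_
  refine tendsto_atTop_add_const_left _ _ (Tendsto.const_mul_atTop hk ?_)
  exact tendsto_atTop_add_const_right _ _ tendsto_id

/-- An exponentially small perturbation cannot push an angle upwards through infinitely many of
the points where `α + ρ cos ψ ≤ 0`. -/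
theorem exists_upper_bound_angle {α ρ C k : ℝ} (hα : |α| ≤ ρ) (hk : 0 < k) {ψ e : ℝ → ℝ}
    (hψ : ∀ t ∈ Ici (0 : ℝ), HasDerivWithinAt ψ (α + ρ * Real.cos (ψ t) + e t) (Ici 0) t)
    (he : ∀ᶠ t in atTop, |e t| ≤ C * Real.exp (-k * t)) : ∃ b, ∀ᶠ t in atTop, ψ t ≤ b := by
  have hρ : 0 ≤ ρ := (abs_nonneg α).trans hα
  set κ : ℝ := 1 / (ρ + 1) with hκ
  have hκ0 : 0 < κ := by positivity
  have hρκ : ρ * κ ≤ 1 := by rw [hκ, mul_one_div, div_le_one (by positivity)]; linarith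
  have hpoly : ∀ᶠ t in atTop, t ^ 2 * (C * Real.exp (-k * t)) < κ / 2 := by
    have h1 : Tendsto (fun t : ℝ => t ^ 2 / Real.exp (k * t)) atTop (𝓝 0) :=
      (isLittleO_pow_exp_pos_mul_atTop 2 hk).tendsto_div_nhds_zero
    have h2 := (h1.const_mul C).eventually (gt_mem_nhds (show C * 0 < κ / 2 by simpa using hκ0))
    filter_upwards [h2] with t ht
    rw [neg_mul, Real.exp_neg]
    calc _ = C * (t ^ 2 / Real.exp (k * t)) := by ring
      _ < κ / 2 := ht
  obtain ⟨T, hT⟩ := eventually_atTop.1 ((he.and hpoly).and (eventually_ge_atTop 1))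
  have hT1 : 1 ≤ T := (hT T le_rfl).2
  obtain ⟨N, hN⟩ := exists_nat_ge ((ψ T + κ) / (2 * Real.pi))
  have hNT : ψ T + κ ≤ N * (2 * Real.pi) := (div_le_iff₀ (by positivity)).1 hN
  set c : ℝ := Real.pi + N * (2 * Real.pi) with hc
  refine ⟨c, (eventually_ge_atTop T).mono fun t ht => ?_⟩
  have hsub : ∀ s, T ≤ s → s ∈ Ici (0 : ℝ) := fun s hs => by
    rw [mem_Ici]; linarith
  -- The barrier rises to the odd multiple `c` of `π`. At contact `cos ψ = -cos (κ / s)`, so `α + ρ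
  -- cos ψ ≤ ρ κ² / (2 s²) ≤ κ / (2 s²)`; the error is below `κ / (2 s²)` too, and the barrier rises
  -- at speed `κ / s²`.
  have key : ψ t ≤ c - κ * t⁻¹ := by
    refine image_le_of_deriv_right_lt_deriv_boundary' (f := ψ)
      (f' := fun t => α + ρ * Real.cos (ψ t) + e t) (a := T) (b := t)
      (B := fun t => c - κ * t⁻¹) (B' := fun t => -(κ * (-(t ^ 2)⁻¹)))
      (fun s hs => (hψ s (hsub s hs.1)).continuousWithinAt.mono fun r hr => hsub r hr.1)
      (fun s hs => (hψ s (hsub s hs.1)).mono fun r hr => hsub r (hs.1.trans hr)) ?_ ?_ ?_ ?_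
      ⟨ht, le_rfl⟩
    · have : κ * T⁻¹ ≤ κ := mul_le_of_le_one_right hκ0.le (inv_le_one_of_one_le₀ hT1)
      have := Real.pi_pos
      simp only [hc]
      linarith
    · intro s hs
      have : s ≠ 0 := (one_pos.trans_le (hT1.trans hs.1)).ne'
      exact (continuousAt_const.sub (continuousAt_const.mul (continuousAt_inv₀ this))).continuousWithinAt
    · intro s hs
      have hs0 : s ≠ 0 := (one_pos.trans_le (hT1.trans hs.1)).ne'
      exact (((hasDerivAt_inv hs0).const_mul κ).const_sub c).hasDerivWithinAt
    · intro s hs hψB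
      have hs1 : 1 ≤ s := hT1.trans hs.1
      have hs0 : 0 < s := by linarith
      have hcos : Real.cos (ψ s) = -Real.cos (κ * s⁻¹) := by
        rw [hψB, hc, add_sub_right_comm, Real.cos_add_nat_mul_two_pi, Real.cos_pi_sub]
      have h1 := Real.one_sub_sq_div_two_le_cos (x := κ * s⁻¹)
      have h2 := (abs_le.1 (hT s hs.1).1.1).2
      have h3 := (hT s hs.1).1.2
      have h4 := (abs_le.1 hα).2
      have h5 := mul_le_mul_of_nonneg_left h1 hρ
      have h6 : C * Real.exp (-k * s) < κ / 2 * (s ^ 2)⁻¹ := by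
        rw [← div_eq_mul_inv, lt_div_iff₀' (by positivity)]
        exact h3
      have h7 : ρ * ((κ * s⁻¹) ^ 2 / 2) ≤ κ / 2 * (s ^ 2)⁻¹ := by
        have : ρ * ((κ * s⁻¹) ^ 2 / 2) = (ρ * κ) * (κ / 2 * (s ^ 2)⁻¹) := by
          rw [mul_pow, inv_pow]; ring
        rw [this]
        exact mul_le_of_le_one_left (by positivity) hρκ
      simp only [hcos]
      have h8 : -(κ * (-(s ^ 2)⁻¹)) = κ / 2 * (s ^ 2)⁻¹ + κ / 2 * (s ^ 2)⁻¹ := by ring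
      rw [h8]
      linarith
  have : 0 < t := by linarith
  have : 0 < κ * t⁻¹ := by positivity
  linarith

/-- It supplies a level that the limit equation crosses in one direction only. Equal cosines at `c`
and `c ± h` would force `sin c = 0` and then `cos h = 1`. -/
theorem exists_mem_Ioo_add_mul_cos_ne_zero {α ρ a b : ℝ} (hρ : 0 < ρ) (hab : a < b) :
    ∃ m ∈ Ioo a b, α + ρ * Real.cos m ≠ 0 := by
  by_contra! hno
  set h := min ((b - a) / 4) 1 with hh
  have h0 : 0 < h := lt_min (by linarith) one_pos
  have h1 : h ≤ (b - a) / 4 := min_le_left _ _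
  have h2 : h ≤ 1 := min_le_right _ _
  set c := (a + b) / 2 with hc
  have e0 := hno c ⟨by linarith, by linarith⟩
  have e1 := hno (c + h) ⟨by linarith, by linarith⟩
  have e2 := hno (c - h) ⟨by linarith, by linarith⟩
  have hsin : 0 < Real.sin h := Real.sin_pos_of_pos_of_lt_pi h0 (by linarith [Real.pi_gt_three])
  have k1 : Real.cos (c + h) = Real.cos c := mul_left_cancel₀ hρ.ne' (by linarith)
  have k2 : Real.cos (c - h) = Real.cos c := mul_left_cancel₀ hρ.ne' (by linarith)
  rw [Real.cos_add] at k1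
  rw [Real.cos_sub] at k2
  have s0 : Real.sin c = 0 := by
    have : Real.sin c * Real.sin h = 0 := by linarith
    exact (mul_eq_zero.1 this).resolve_right hsin.ne'
  have k3 : Real.cos c * (1 - Real.cos h) = 0 := by rw [s0] at k1; linarith
  have hpy := Real.sin_sq_add_cos_sq c
  have hpy2 := Real.sin_sq_add_cos_sq h
  rcases mul_eq_zero.1 k3 with h3 | h3
  · rw [s0, h3] at hpy; norm_num at hpy
  · have : Real.cos h = 1 := by linarith
    rw [this] at hpy2
    nlinarith

/-- An angle moving by `ψ' = α + ρ cos ψ`, `|α| ≤ ρ`, up to an exponentially small error,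
converges. -/
theorem exists_tendsto_angle {α ρ C k : ℝ} (hα : |α| ≤ ρ) (hk : 0 < k) {ψ e : ℝ → ℝ}
    (hψ : ∀ t ∈ Ici (0 : ℝ), HasDerivWithinAt ψ (α + ρ * Real.cos (ψ t) + e t) (Ici 0) t)
    (he : ∀ᶠ t in atTop, |e t| ≤ C * Real.exp (-k * t)) : ∃ c, Tendsto ψ atTop (𝓝 c) := by
  obtain ⟨b₁, hb₁⟩ := exists_upper_bound_angle hα hk hψ he
  -- The reflected angle `π - ψ` satisfies an equation of the same form with `-α`, so its upper
  -- bound is a lower bound for `ψ`.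
  obtain ⟨b₂, hb₂⟩ := exists_upper_bound_angle (α := -α) (ρ := ρ) (C := C) (k := k)
    (ψ := fun t => Real.pi - ψ t) (e := fun t => -e t) (by rwa [abs_neg]) hk
    (fun t ht => by
      convert! (hψ t ht).const_sub Real.pi using 1
      rw [Real.cos_pi_sub]; ring)
    (by simpa only [abs_neg] using he)
  have hρ : 0 ≤ ρ := (abs_nonneg α).trans hα
  have hezero : Tendsto e atTop (𝓝 0) := by
    refine squeeze_zero_norm' he ?_
    simpa using (tendsto_exp_neg_mul_atTop hk).const_mul C
  -- A bounded function without a limit passes infinitely often below some `a` and above some `b >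
  -- a`. For `ρ = 0` the integrable error excludes this; otherwise a level `m` between them is
  -- eventually crossed in one direction only.
  refine tendsto_of_no_upcrossings dense_univ ?_ ⟨b₁, eventually_map.2 hb₁⟩
    ⟨Real.pi - b₂, eventually_map.2 (hb₂.mono fun t ht => by linarith)⟩
  rintro a - b - hab ⟨hfa, hfb⟩
  rcases hρ.eq_or_lt with hρ0 | hρ0
  · have hα0 : α = 0 := by rw [← hρ0] at hα; exact abs_eq_zero.1 (le_antisymm hα (abs_nonneg _))
    have hlim : ∀ᶠ t in atTop, a + |C| / k * Real.exp (-k * t) < b := by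
      have := ((tendsto_exp_neg_mul_atTop hk).const_mul (|C| / k)).const_add a
      exact this.eventually (gt_mem_nhds (by simpa using hab))
    obtain ⟨T, hT⟩ := eventually_atTop.1 ((he.and hlim).and (eventually_ge_atTop 0))
    obtain ⟨s, hsT, hsa⟩ := frequently_atTop.1 hfa T
    obtain ⟨t, hst, htb⟩ := frequently_atTop.1 hfb s
    have hmem : ∀ r, s ≤ r → r ∈ Ici (0 : ℝ) := fun r hr => (hT r (hsT.trans hr)).2
    have : ψ t ≤ a + |C| / k * (Real.exp (-k * s) - Real.exp (-k * t)) := by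
      refine image_le_of_deriv_right_le_deriv_boundary (f := ψ) (a := s) (b := t)
        (f' := fun t => α + ρ * Real.cos (ψ t) + e t)
        (B := fun t => a + |C| / k * (Real.exp (-k * s) - Real.exp (-k * t)))
        (B' := fun t => |C| * Real.exp (-k * t))
        (fun r hr => (hψ r (hmem r hr.1)).continuousWithinAt.mono fun q hq => hmem q hq.1)
        (fun r hr => (hψ r (hmem r hr.1)).mono fun q hq => hmem q (hr.1.trans hq))
        (by simpa using hsa.le) (by fun_prop) ?_ ?_ ⟨hst, le_rfl⟩
      · intro r _
        have h2 : HasDerivAt (fun t : ℝ => Real.exp (-k * t)) (Real.exp (-k * r) * (-k)) r := by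
          simpa using ((hasDerivAt_id r).const_mul (-k)).exp
        have h3 := ((h2.const_sub (Real.exp (-k * s))).const_mul (|C| / k)).const_add a
        convert! h3.hasDerivWithinAt using 1
        field_simp
      · intro r hr
        have h1 := (abs_le.1 (hT r (hsT.trans hr.1)).1.1).2
        have h2 := mul_le_mul_of_nonneg_right (le_abs_self C) (Real.exp_pos (-k * r)).le
        rw [hα0, ← hρ0]
        linarith
    have h3 := (hT s hsT).1.2
    have h4 : 0 ≤ |C| / k * Real.exp (-k * t) := by positivity
    linarith
  · obtain ⟨m, hm, hmne⟩ := exists_mem_Ioo_add_mul_cos_ne_zero (α := α) hρ0 hab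
    have hsmall : ∀ᶠ t in atTop, |e t| < |α + ρ * Real.cos m| := by
      have := hezero.abs
      rw [abs_zero] at this
      exact this.eventually (gt_mem_nhds (abs_pos.2 hmne))
    obtain ⟨T, hT⟩ := eventually_atTop.1 (hsmall.and (eventually_ge_atTop 0))
    rcases lt_or_gt_of_ne hmne with hneg | hpos
    · obtain ⟨s, hsT, hsa⟩ := frequently_atTop.1 hfa T
      obtain ⟨t, hst, htb⟩ := frequently_atTop.1 hfb s
      have := le_const_of_barrier (hT s hsT).2 hψ (m := m) (fun r hr hrm => by
        have h1 := (hT r (hsT.trans hr)).1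
        rw [abs_of_neg hneg] at h1
        rw [hrm]
        linarith [(abs_lt.1 h1).2]) (hsa.le.trans hm.1.le) t hst
      linarith [hm.2]
    · obtain ⟨s, hsT, hsb⟩ := frequently_atTop.1 hfb T
      obtain ⟨t, hst, hta⟩ := frequently_atTop.1 hfa s
      have := le_const_of_barrier (hT s hsT).2 (fun t ht => (hψ t ht).neg) (m := -m)
        (fun r hr hrm => by
          have h1 := (hT r (hsT.trans hr)).1
          rw [abs_of_pos hpos] at h1
          rw [show ψ r = m by simpa using hrm]
          linarith [(abs_lt.1 h1).1]) (by simpa using (hm.2.trans hsb).le) t hst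
      have h2 : m ≤ ψ t := by simpa using this
      linarith [hm.1]

/-! ### The direction of an incoming trajectory -/

/-- At a zero of `f` the solution would stay put, so its limit `p` would be that point. -/
theorem IsIncoming.field_ne_zero {f : Plane → Plane} (hf : ContDiff ℝ 1 f) {p : Plane}
    {x : ℝ → Plane} (hx : IsIncoming f p x) : ∀ t ∈ Ici (0 : ℝ), f (x t) ≠ 0 := by
  intro T hT h0
  have h1 : IsIntegralCurveOn (fun _ => x T) (fun _ => f) (Ici 0) := fun t _ => by
    simpa [h0] using hasDerivWithinAt_const t (Ici (0 : ℝ)) (x T)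
  have h2 := IsIntegralCurveOn.eqOn_of_locallyLipschitz hf.locallyLipschitz
    (IsIntegralCurveOn.shift_Ici hx.1 hT) h1 (by simp)
  have h3 : Tendsto x atTop (𝓝 (x T)) := by
    refine tendsto_const_nhds.congr' ?_
    filter_upwards [eventually_ge_atTop T] with t ht
    have := h2 (show t - T ∈ Ici 0 from sub_nonneg.2 ht)
    simpa using this.symm
  exact hx.2.1 T hT (tendsto_nhds_unique h3 hx.2.2)

/-- The angular speed of a solution of `y' = J y` at the angle `θ`. -/
noncomputable def angularSpeed (J : Matrix (Fin 2) (Fin 2) ℝ) (θ : ℝ) : ℝ :=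
  J 1 0 * Real.cos θ ^ 2 + (J 1 1 - J 0 0) * (Real.cos θ * Real.sin θ) - J 0 1 * Real.sin θ ^ 2

theorem abs_angularSpeed_sub_le (J A : Matrix (Fin 2) (Fin 2) ℝ) (θ : ℝ) :
    |angularSpeed J θ - angularSpeed A θ| ≤ ∑ i, ∑ j, |J i j - A i j| := by
  have hc := Real.abs_cos_le_one θ
  have hs := Real.abs_sin_le_one θ
  have key : ∀ a u v : ℝ, |u| ≤ 1 → |v| ≤ 1 → |a * (u * v)| ≤ |a| := fun a u v hu hv => by
    rw [abs_mul, abs_mul]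
    exact mul_le_of_le_one_right (abs_nonneg _) (mul_le_one₀ hu (abs_nonneg _) hv)
  have e : angularSpeed J θ - angularSpeed A θ = (J 1 0 - A 1 0) * (Real.cos θ * Real.cos θ) +
      (J 1 1 - A 1 1) * (Real.cos θ * Real.sin θ) - (J 0 0 - A 0 0) * (Real.cos θ * Real.sin θ) -
      (J 0 1 - A 0 1) * (Real.sin θ * Real.sin θ) := by
    unfold angularSpeed; ring
  have h1 := key (J 1 0 - A 1 0) _ _ hc hc
  have h2 := key (J 1 1 - A 1 1) _ _ hc hs
  have h3 := key (J 0 0 - A 0 0) _ _ hc hs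
  have h4 := key (J 0 1 - A 0 1) _ _ hs hs
  rw [e, Fin.sum_univ_two, Fin.sum_univ_two, Fin.sum_univ_two]
  rw [abs_le] at h1 h2 h3 h4 ⊢
  constructor <;> linarith

/-- Polar form of the angular speed; `r ^ 2 - a ^ 2` is a quarter of the discriminant of the
characteristic polynomial. -/
theorem exists_angularSpeed_eq (A : Matrix (Fin 2) (Fin 2) ℝ) :
    ∃ a r φ : ℝ, 0 ≤ r ∧ 4 * (r ^ 2 - a ^ 2) = A.trace ^ 2 - 4 * A.det ∧
      ∀ θ, angularSpeed A θ = a + r * Real.cos (2 * θ - φ) := by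
  -- In terms of `2θ` the speed is a constant plus a sinusoid; `z` holds the coefficients of `cos
  -- 2θ` and `sin 2θ`.
  let z : ℂ := ⟨(A 1 0 + A 0 1) / 2, (A 1 1 - A 0 0) / 2⟩
  refine ⟨(A 1 0 - A 0 1) / 2, ‖z‖, z.arg, norm_nonneg _, ?_, fun θ => ?_⟩
  · rw [Complex.sq_norm, Complex.normSq_mk, Matrix.trace_fin_two, Matrix.det_fin_two]
    ring
  · have h1 : ‖z‖ * Real.cos z.arg = (A 1 0 + A 0 1) / 2 := Complex.norm_mul_cos_arg z
    have h2 : ‖z‖ * Real.sin z.arg = (A 1 1 - A 0 0) / 2 := Complex.norm_mul_sin_arg z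
    rw [Real.cos_sub, Real.cos_two_mul', Real.sin_two_mul]
    unfold angularSpeed
    linear_combination (-(Real.cos θ ^ 2 - Real.sin θ ^ 2)) * h1 -
      2 * Real.sin θ * Real.cos θ * h2 +
      (A 1 0 - A 0 1) / 2 * Real.sin_sq_add_cos_sq θ

/-- The velocity `y = f(x(t))` solves `y' = Df(x(t)) y`. The angular speed of a linear equation
depends on the angle alone, so `|y|` cancels. -/
theorem IsIncoming.exists_direction_angle {f : Plane → Plane} (hf : ContDiff ℝ 1 f) {p : Plane}
    {x : ℝ → Plane} (hx : IsIncoming f p x) :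
    ∃ θ : ℝ → ℝ, (∀ t ∈ Ici (0 : ℝ),
      HasDerivWithinAt θ (angularSpeed (jacobian f (x t)) (θ t)) (Ici 0) t) ∧
      ∀ t ∈ Ici (0 : ℝ), direction f x t = !₂[Real.cos (θ t), Real.sin (θ t)] := by
  have hne := hx.field_ne_zero hf
  have hy : ∀ t ∈ Ici (0 : ℝ), HasDerivWithinAt (fun t => f (x t))
      (fderiv ℝ f (x t) (f (x t))) (Ici 0) t := fun t ht =>
    ((hf.differentiable one_ne_zero (x t)).hasFDerivAt).comp_hasDerivWithinAt t (hx.1 t ht)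
  have hxc : ContinuousOn x (Ici 0) := IsIntegralCurveOn.continuousOn hx.1
  have hy' : ContinuousOn (fun t => fderiv ℝ f (x t) (f (x t))) (Ici 0) :=
    ((hf.continuous_fderiv one_ne_zero).comp_continuousOn hxc).clm_apply
      (hf.continuous.comp_continuousOn hxc)
  obtain ⟨θ, hθ, hang⟩ := exists_angle hy hy' hne
  refine ⟨θ, fun t ht => ?_, fun t ht => ?_⟩
  · convert! hθ t ht using 1
    obtain ⟨h0, h1⟩ := hang t ht
    have hn : ‖f (x t)‖ ≠ 0 := norm_ne_zero_iff.2 (hne t ht)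
    rw [fderiv_apply_eq_jacobian, fderiv_apply_eq_jacobian, eq_div_iff (pow_ne_zero 2 hn)]
    rw [h0, h1]
    unfold angularSpeed
    ring
  · obtain ⟨h0, h1⟩ := hang t ht
    have hn : ‖f (x t)‖ ≠ 0 := norm_ne_zero_iff.2 (hne t ht)
    ext i
    fin_cases i
    · simp [direction, h0, hn]
    · simp [direction, h1, hn]

/-! ### Nodes and foci: the attracting case -/

theorem continuous_jacobian_apply {f : Plane → Plane} (hf : ContDiff ℝ 1 f) (i j : Fin 2) :
    Continuous fun x => jacobian f x i j := by
  have h := (hf.continuous_fderiv one_ne_zero).clm_apply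
    (continuous_const (y := (EuclideanSpace.single j 1 : Plane)))
  exact (EuclideanSpace.proj i : Plane →L[ℝ] ℝ).continuous.comp h

/-- A negative discriminant means `r < |a|`, so the speed `a + r cos` keeps the sign of `a`.
Continuity of the Jacobian suffices to preserve a gap `(|a| - r) / 2`. -/
theorem IsIncoming.directionRotates {f : Plane → Plane} (hf : ContDiff ℝ 1 f) {p : Plane}
    {x : ℝ → Plane} (hx : IsIncoming f p x)
    (hdisc : (jacobian f p).trace ^ 2 < 4 * (jacobian f p).det) :
    DirectionRotates f x (Ici 0) atTop := by
  obtain ⟨θ, hθ, hdir⟩ := hx.exists_direction_angle hf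
  refine ⟨θ, fun t ht => (hθ t ht).continuousWithinAt, hdir, ?_⟩
  obtain ⟨a, r, φ, hr, har, hA⟩ := exists_angularSpeed_eq (jacobian f p)
  have hra : r < |a| := by
    have : r ^ 2 < a ^ 2 := by linarith
    exact (le_abs_self r).trans_lt (sq_lt_sq.1 this)
  have herr : Tendsto (fun t => ∑ i, ∑ j, |jacobian f (x t) i j - jacobian f p i j|) atTop (𝓝 0) := by
    have : ∀ i j, Tendsto (fun t => |jacobian f (x t) i j - jacobian f p i j|) atTop (𝓝 0) :=
      fun i j => by
        have := (((continuous_jacobian_apply hf i j).tendsto p).comp hx.2.2).sub_const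
          (jacobian f p i j)
        simpa using this.abs
    simpa using tendsto_finsetSum Finset.univ fun i _ =>
      tendsto_finsetSum Finset.univ fun j _ => this i j
  have hsmall := herr.eventually (gt_mem_nhds (show 0 < (|a| - r) / 2 by linarith))
  have hcos : ∀ s, |r * Real.cos (2 * s - φ)| ≤ r := fun s => by
    rw [abs_mul, abs_of_nonneg hr]
    exact mul_le_of_le_one_right hr (Real.abs_cos_le_one _)
  have hbound : ∀ᶠ t in atTop, |angularSpeed (jacobian f (x t)) (θ t) - a| ≤ (|a| + r) / 2 := by
    filter_upwards [hsmall] with t ht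
    have h1 := abs_le.1 (abs_angularSpeed_sub_le (jacobian f (x t)) (jacobian f p) (θ t))
    have h2 := abs_le.1 (hcos (θ t))
    rw [hA] at h1
    rw [abs_le]
    constructor <;> linarith
  have hk : 0 < (|a| - r) / 2 := by linarith
  rcases le_total 0 a with h | h
  · refine Or.inl (tendsto_atTop_of_deriv_ge hθ hk ?_)
    filter_upwards [hbound] with t ht
    rw [abs_of_nonneg h] at ht ⊢
    linarith [(abs_le.1 ht).1]
  · refine Or.inr (tendsto_neg_atTop_iff.1 (tendsto_atTop_of_deriv_ge
      (fun t ht => (hθ t ht).neg) hk ?_))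
    filter_upwards [hbound] with t ht
    rw [abs_of_nonpos h] at ht ⊢
    linarith [(abs_le.1 ht).2]

/-- The variable `2θ - φ` obeys the model equation with coefficients `2a` and `2r`. Its error is at
most a constant times `|x - p|^α`, hence exponentially small. -/
theorem IsIncoming.directionConverges {f : Plane → Plane} {α : NNReal} (hα : 0 < α)
    (hf : IsClassC1Holder α f) {p : Plane} (hp : f p = 0) (hdet : 0 < (jacobian f p).det)
    (htr : (jacobian f p).trace < 0) (hdisc : 4 * (jacobian f p).det ≤ (jacobian f p).trace ^ 2)
    {x : ℝ → Plane} (hx : IsIncoming f p x) : DirectionConverges f x atTop := by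
  obtain ⟨θ, hθ, hdir⟩ := hx.exists_direction_angle hf.1
  obtain ⟨a, r, φ, hr, har, hA⟩ := exists_angularSpeed_eq (jacobian f p)
  have hra : |a| ≤ r := by
    have : a ^ 2 ≤ r ^ 2 := by linarith
    exact abs_le_of_sq_le_sq this hr
  obtain ⟨K, hK, c, hc, hdecay⟩ := hx.exponential_decay hf.1 hp hdet htr
  have hentry : ∀ i j, ∃ C : ℝ, ∀ᶠ t in atTop,
      |jacobian f (x t) i j - jacobian f p i j| ≤ C * Real.exp (-(c * α) * t) := by
    intro i j
    obtain ⟨U, hU, C, hC⟩ := hf.2 i j p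
    refine ⟨C * K ^ (α : ℝ), ?_⟩
    filter_upwards [hdecay, hx.2.2.eventually hU] with t ht htU
    rw [← dist_eq_norm] at ht
    have h1 := hC.dist_le_of_le htU (mem_of_mem_nhds hU) ht
    rw [Real.dist_eq, Real.mul_rpow hK.le (Real.exp_pos _).le, ← Real.exp_mul] at h1
    refine h1.trans_eq ?_
    ring_nf
  choose C hC using hentry
  have hα' : (0 : ℝ) < α := hα
  obtain ⟨l, hψ⟩ := exists_tendsto_angle (α := 2 * a) (ρ := 2 * r)
    (C := 2 * ∑ i, ∑ j, C i j) (k := c * α) (ψ := fun t => 2 * θ t - φ)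
    (e := fun t => 2 * (angularSpeed (jacobian f (x t)) (θ t) - angularSpeed (jacobian f p) (θ t)))
    (by rw [abs_mul, abs_two]; linarith) (by positivity)
    (fun t ht => by
      convert! ((hθ t ht).const_mul 2).sub_const φ using 1
      rw [hA]; ring)
    (by
      have hall : ∀ᶠ t in atTop, ∀ i j,
          |jacobian f (x t) i j - jacobian f p i j| ≤ C i j * Real.exp (-(c * α) * t) :=
        eventually_all.2 fun i => eventually_all.2 fun j => hC i j
      filter_upwards [hall] with t ht
      rw [abs_mul, abs_two, mul_assoc, Finset.sum_mul]
      refine mul_le_mul_of_nonneg_left ((abs_angularSpeed_sub_le _ _ _).trans ?_) two_pos.le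
      refine Finset.sum_le_sum fun i _ => ?_
      rw [Finset.sum_mul]
      exact Finset.sum_le_sum fun j _ => ht i j)
  have hlim : Tendsto θ atTop (𝓝 ((l + φ) / 2)) := by
    have := (hψ.add_const φ).div_const 2
    simpa using this
  refine ⟨!₂[Real.cos ((l + φ) / 2), Real.sin ((l + φ) / 2)], ?_, ?_⟩
  · rw [EuclideanSpace.norm_eq, Fin.sum_univ_two]
    simp
  · have hcont : Continuous fun s : ℝ => (!₂[Real.cos s, Real.sin s] : Plane) := by
      refine (PiLp.continuous_toLp 2 _).comp (continuous_pi fun i => ?_)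
      fin_cases i
      · exact Real.continuous_cos
      · exact Real.continuous_sin
    refine ((hcont.tendsto _).comp hlim).congr' ?_
    filter_upwards [eventually_ge_atTop 0] with t ht
    exact (hdir t ht).symm

/-! ### Time reversal of the classes of equilibria -/

theorem jacobian_neg (f : Plane → Plane) (x : Plane) : jacobian (-f) x = -jacobian f x := by
  ext i j
  simp [jacobian, fderiv_neg]

theorem IsClassC1Holder.neg {α : NNReal} {f : Plane → Plane} (hf : IsClassC1Holder α f) :
    IsClassC1Holder α (-f) := by
  refine ⟨hf.1.neg, fun i j x => ?_⟩
  obtain ⟨U, hU, C, hC⟩ := hf.2 i j x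
  refine ⟨U, hU, C, fun y hy z hz => ?_⟩
  simp only [jacobian_neg, Matrix.neg_apply, edist_neg_neg]
  exact hC y hy z hz

theorem IsAttracting.isRepelling {f : Plane → Plane} {p : Plane} (h : IsAttracting (-f) p) :
    IsRepelling f p := by
  refine ⟨by simpa using h.1, fun ε hε => ?_⟩
  obtain ⟨δ, hδ, H⟩ := h.2 ε hε
  refine ⟨δ, hδ, fun x₀ hx₀ => ⟨?_, fun x hx0 hx => ?_⟩⟩
  · obtain ⟨x, hx0, hx⟩ := (H x₀ hx₀).1
    exact ⟨fun t => x (-t), by simpa using hx0,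
      IsIntegralCurveOn.comp_neg_of_neg hx (fun t ht => by simpa using ht) (neg_neg f).symm⟩
  · obtain ⟨h1, h2⟩ := (H x₀ hx₀).2 (fun t => x (-t)) (by simpa using hx0)
      (IsIntegralCurveOn.comp_neg_of_neg hx (fun t ht => by simpa using ht) rfl)
    refine ⟨fun t ht => by simpa using h1 (-t) (by simpa using ht), ?_⟩
    simpa [Function.comp_def] using h2.comp tendsto_neg_atBot_atTop

theorem direction_neg_comp_neg (f : Plane → Plane) (x : ℝ → Plane) (t : ℝ) :
    direction f x t = -direction (-f) (fun t => x (-t)) (-t) := by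
  simp [direction]

theorem DirectionConverges.of_reverse {f : Plane → Plane} {x : ℝ → Plane}
    (h : DirectionConverges (-f) (fun t => x (-t)) atTop) : DirectionConverges f x atBot := by
  obtain ⟨v, hv, hlim⟩ := h
  refine ⟨-v, by rwa [norm_neg], ?_⟩
  refine ((hlim.comp tendsto_neg_atBot_atTop).neg).congr fun t => ?_
  rw [direction_neg_comp_neg f x t]; rfl

theorem DirectionRotates.of_reverse {f : Plane → Plane} {x : ℝ → Plane}
    (h : DirectionRotates (-f) (fun t => x (-t)) (Ici 0) atTop) :
    DirectionRotates f x (Iic 0) atBot := by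
  obtain ⟨θ, hθ, hdir, hlim⟩ := h
  have hmaps : MapsTo (fun t : ℝ => -t) (Iic 0) (Ici 0) := fun t ht => by simpa using ht
  -- Reversing time flips the direction vector, which shifts the angle by `π`.
  refine ⟨fun t => θ (-t) + Real.pi, (hθ.comp continuousOn_neg hmaps).add_const _,
    fun t ht => ?_, hlim.imp (fun h => ?_) (fun h => ?_)⟩
  · rw [direction_neg_comp_neg, hdir (-t) (hmaps ht), Real.cos_add_pi, Real.sin_add_pi]
    ext i
    fin_cases i <;> simp
  · exact tendsto_atTop_add_const_right _ _ (h.comp tendsto_neg_atBot_atTop)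
  · exact tendsto_atBot_add_const_right _ _ (h.comp tendsto_neg_atBot_atTop)

theorem trace_jacobian_neg (f : Plane → Plane) (p : Plane) :
    (jacobian (-f) p).trace = -(jacobian f p).trace := by
  rw [jacobian_neg, Matrix.trace_neg]

theorem det_jacobian_neg (f : Plane → Plane) (p : Plane) :
    (jacobian (-f) p).det = (jacobian f p).det := by
  rw [jacobian_neg, Matrix.det_fin_two, Matrix.det_fin_two]
  simp

/-! ### Classification by trace and determinant -/

theorem isNode_of_discrim_nonneg {α : NNReal} (hα : 0 < α) {f : Plane → Plane}
    (hf : IsClassC1Holder α f) {p : Plane} (hp : f p = 0) (hdet : 0 < (jacobian f p).det)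
    (hdisc : 4 * (jacobian f p).det ≤ (jacobian f p).trace ^ 2) : IsNode f p := by
  rcases lt_trichotomy (jacobian f p).trace 0 with h | h | h
  · exact Or.inl ⟨isAttracting_of_det_pos_of_trace_neg hf.1 hp hdet h,
      fun x hx => hx.directionConverges hα hf hp hdet h hdisc⟩
  · rw [h] at hdisc; linarith
  · have h0 : (-f) p = 0 := by simp [hp]
    have h1 : (jacobian (-f) p).trace < 0 := by rw [trace_jacobian_neg]; linarith
    have h2 : 0 < (jacobian (-f) p).det := by rwa [det_jacobian_neg]
    refine Or.inr ⟨(isAttracting_of_det_pos_of_trace_neg hf.1.neg h0 h2 h1).isRepelling,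
      fun x hx => DirectionConverges.of_reverse ?_⟩
    exact hx.isIncoming.directionConverges hα hf.neg h0 h2 h1
      (by rwa [trace_jacobian_neg, det_jacobian_neg, neg_sq])

theorem isFocus_of_discrim_neg {f : Plane → Plane} (hf : ContDiff ℝ 1 f) {p : Plane}
    (hp : f p = 0) (htr : (jacobian f p).trace ≠ 0)
    (hdisc : (jacobian f p).trace ^ 2 < 4 * (jacobian f p).det) : IsFocus f p := by
  have hdet : 0 < (jacobian f p).det := by linarith [sq_nonneg (jacobian f p).trace]
  rcases lt_or_gt_of_ne htr with h | h
  · exact Or.inl ⟨isAttracting_of_det_pos_of_trace_neg hf hp hdet h,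
      fun x hx => hx.directionRotates hf hdisc⟩
  · have h0 : (-f) p = 0 := by simp [hp]
    have h1 : (jacobian (-f) p).trace < 0 := by rw [trace_jacobian_neg]; linarith
    have h2 : 0 < (jacobian (-f) p).det := by rwa [det_jacobian_neg]
    refine Or.inr ⟨(isAttracting_of_det_pos_of_trace_neg hf.neg h0 h2 h1).isRepelling,
      fun x hx => DirectionRotates.of_reverse ?_⟩
    exact hx.isIncoming.directionRotates (show ContDiff ℝ 1 (-f) from hf.neg)
      (by rwa [trace_jacobian_neg, det_jacobian_neg, neg_sq])

/-! ### From eigenvalues to trace and determinant. -/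

theorem trace_det_of_charpoly_roots {A : Matrix (Fin 2) (Fin 2) ℝ} {μ₁ μ₂ : ℂ}
    (hμ : (A.map Complex.ofReal).charpoly.roots = {μ₁, μ₂}) :
    (A.trace : ℂ) = μ₁ + μ₂ ∧ (A.det : ℂ) = μ₁ * μ₂ := by
  have h1 := Matrix.trace_eq_sum_roots_charpoly (A.map Complex.ofReal)
  have h2 := Matrix.det_eq_prod_roots_charpoly (A.map Complex.ofReal)
  rw [hμ] at h1 h2
  rw [Matrix.trace_fin_two] at h1 ⊢
  rw [Matrix.det_fin_two] at h2 ⊢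
  simp only [Matrix.map_apply, Multiset.insert_eq_cons, Multiset.sum_cons, Multiset.sum_singleton,
    Multiset.prod_cons, Multiset.prod_singleton] at h1 h2
  push_cast
  exact ⟨h1, h2⟩

theorem theorem2 (α : NNReal) (hα : 0 < α) (f : Plane → Plane) (hf : IsClassC1Holder α f)
    (p : Plane) (hp : f p = 0) (μ₁ μ₂ : ℂ)
    (hμ : ((jacobian f p).map Complex.ofReal).charpoly.roots = {μ₁, μ₂}) :
    (μ₁.im = 0 → μ₂.im = 0 → 0 < μ₁.re * μ₂.re → IsNode f p) ∧
    (μ₁.im = 0 → μ₂.im = 0 → μ₁.re * μ₂.re < 0 → IsSaddle f p) ∧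
    (μ₁.im ≠ 0 → μ₂.im ≠ 0 → μ₁.re ≠ 0 → μ₂.re ≠ 0 → IsFocus f p) := by
  obtain ⟨htr, hdet⟩ := trace_det_of_charpoly_roots hμ
  have htr_re := congrArg Complex.re htr
  have htr_im := congrArg Complex.im htr
  have hdet_re := congrArg Complex.re hdet
  have hdet_im := congrArg Complex.im hdet
  simp only [Complex.ofReal_re, Complex.ofReal_im, Complex.add_re, Complex.add_im, Complex.mul_re,
    Complex.mul_im] at htr_re htr_im hdet_re hdet_im
  refine ⟨fun h1 h2 h => ?_, fun h1 h2 h => ?_, fun h1 h2 h3 _ => ?_⟩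
  · rw [h1, zero_mul, sub_zero] at hdet_re
    refine isNode_of_discrim_nonneg hα hf hp (by rwa [hdet_re]) ?_
    rw [hdet_re, htr_re]
    nlinarith [sq_nonneg (μ₁.re - μ₂.re)]
  · rw [h1, zero_mul, sub_zero] at hdet_re
    exact isSaddle_of_det_neg hf.1 hp (by rwa [hdet_re])
  · have him : μ₂.im = -μ₁.im := by linarith
    have hre : μ₂.re = μ₁.re := by
      rw [him] at hdet_im
      have : μ₁.im * (μ₂.re - μ₁.re) = 0 := by linarith
      linarith [(mul_eq_zero.1 this).resolve_left h1]
    rw [hre] at htr_re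
    rw [hre, him] at hdet_re
    refine isFocus_of_discrim_neg hf.1 hp ?_ ?_
    · rw [htr_re]
      intro h
      exact h3 (by linarith)
    · rw [hdet_re, htr_re]
      have := sq_pos_of_ne_zero h1
      nlinarith
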